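/- Let $k$ be a field, $R = k[x,y,z]$, and $\mathfrak m = (x,y,z)$. Let $a_1,a_2,b_1,b_2,c_1,c_2$ be positive integers, $$M = \begin{bmatrix} x^{a_1} & y^{b_1} & z^{c_1} \\ z^{c_2} & x^{a_2} & y^{b_2} \end{bmatrix},$$ and let $P = I_2(M) \subseteq R$ be the ideal generated by the $2\times 2$ minors of $M$. Suppose that $P$ is a prime ideal and that $M$ is of type $1'$, that is, $a_1 \le a_2$, $b_1 = b_2$, $c_1 \ge c_2$ and $a_2/a_1 \le c_1/c_2$. Let $r = \lfloor a_2/a_1 \rfloor + 1$ and $n = \lfloor (r+1)/2 \rfloor + 1$, and let $P^{(l)} = P^l R_P \cap R$ denote the $l$th symbolic power of $P$. Then $P^{(2l-1)} \not\subseteq \mathfrak m P^l$ for $1 \le l \le n-1$, and $P^{(2n-1)} \subseteq \mathfrak m P^n$. In other words, $n$ is the smallest positive integer $m$ with $P^{(2m-1)} \subseteq \mathfrak m P^m$. -/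

import Mathlib

namespace SpaceMonomialCurve

open MvPolynomial

/-- The `n`-th symbolic power `P^(n) = P^n R_P ∩ R` of a prime ideal `P` of a commutative
ring `R`: the contraction to `R` of the extension of `P^n` to the localization `R_P`. -/
def symbolicPower {R : Type*} [CommRing R] (P : Ideal R) [P.IsPrime] (n : ℕ) : Ideal R :=
  ((P ^ n).map (algebraMap R (Localization.AtPrime P))).comap
    (algebraMap R (Localization.AtPrime P))

/-- The ideal `I₂(M)` generated by the maximal (that is, `2 × 2`) minors of a `2 × 3` matrix `M`;
a minor is given by an increasing choice `j` of two columns. -/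
def minorsIdeal {R : Type*} [CommRing R] (M : Matrix (Fin 2) (Fin 3) R) : Ideal R :=
  Ideal.span {d | ∃ j : Fin 2 ↪o Fin 3, d = (M.submatrix id j).det}

/-- The matrix with rows `x^a₁, y^b₁, z^c₁` and `z^c₂, x^a₂, y^b₂` over `k[x, y, z]`,
where `x = X 0`, `y = X 1`, `z = X 2`. -/
noncomputable def curveMatrix (k : Type*) [Field k] (a₁ a₂ b₁ b₂ c₁ c₂ : ℕ) :
    Matrix (Fin 2) (Fin 3) (MvPolynomial (Fin 3) k) :=
  !![X 0 ^ a₁, X 1 ^ b₁, X 2 ^ c₁;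
     X 2 ^ c₂, X 0 ^ a₂, X 1 ^ b₂]

/-- The ideal `P = I₂(M)` of `k[x, y, z]` for the matrix `M` with the given exponents. -/
noncomputable def curveIdeal (k : Type*) [Field k] (a₁ a₂ b₁ b₂ c₁ c₂ : ℕ) :
    Ideal (MvPolynomial (Fin 3) k) :=
  minorsIdeal (curveMatrix k a₁ a₂ b₁ b₂ c₁ c₂)

/-- The maximal ideal `𝔪 = (x, y, z)` of `k[x, y, z]`. -/
noncomputable def irrelevantIdeal (k : Type*) [Field k] : Ideal (MvPolynomial (Fin 3) k) :=
  Ideal.span {X 0, X 1, X 2}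

/-- The conditions on the (positive) exponents of the matrix `M` for it to be of type `1'`. The
primality of `I₂(M)`, which is also part of that notion, is stated separately. -/
structure IsTypeOnePrime (a₁ a₂ b₁ b₂ c₁ c₂ : ℕ) : Prop where
  a₁_pos : 0 < a₁
  a₂_pos : 0 < a₂
  b₁_pos : 0 < b₁
  b₂_pos : 0 < b₂
  c₁_pos : 0 < c₁
  c₂_pos : 0 < c₂
  a_le : a₁ ≤ a₂
  b_eq : b₁ = b₂
  c_le : c₂ ≤ c₁
  ratio_le : (a₂ : ℚ) / (a₁ : ℚ) ≤ (c₁ : ℚ) / (c₂ : ℚ)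

/-- The number `r = ⌊a₂ / a₁⌋ + 1`; `/` on natural numbers is division rounded down. -/
def rIndex (a₁ a₂ : ℕ) : ℕ := a₂ / a₁ + 1

/-- The number `n = ⌊(r + 1) / 2⌋ + 1`; `/` on natural numbers is division rounded down. -/
def nIndex (a₁ a₂ : ℕ) : ℕ := (rIndex a₁ a₂ + 1) / 2 + 1

end SpaceMonomialCurve

/-!
Write `q = ⌊a₂ / a₁⌋`, `r = q + 1`, and `f`, `g`, `h` for the minors of `M`, up to sign. The linear
relations between the minors produce elements `d j` with `d 1 = f`,

  `x ^ a₁ * d (j + 1) = d j * g - z ^ (c₁ - j c₂) * h ^ (j + 1)`  (`1 ≤ j ≤ q`),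

and it follows that `d j ∈ P^(j)` for `j ≤ r`. For type `1'` these divisions are possible up to
`j = r`. On the `y`-axis `d j` restricts to `± y ^ (b₁ (j + 1))`, while `P` restricts to `(y ^ (2 b₁))`;
so `d (2 l - 1)` is not in `𝔪 P ^ l`, as long as `2 l - 1 ≤ r`, that is, `l ≤ n - 1`
(`IsTypeOnePrime.d_notMem`).

For the containment, `2 n - 1` is `r + 1` or `r + 2` according to the parity of `r`, and these two
symbolic powers are determined. There is one new element `e` of order `r + 1`, and

  `P^(r+1) = (e) + (g, h)^(r+1) + d r * P`,
  `P^(r+2) = e * (g, h) + (g, h)^(r+2) + d r * (g, h)^2 + (d 2 * d r)`.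

Since `P` is the complete intersection `(g, h)` after inverting `x`, the symbolic power `P^(i)` is the
saturation of `(g, h)^i` by `x` (`symbolicPower_le_of_span_pair_pow_le`). So only the inclusions `⊆` are
needed, and they amount to the fact that the right-hand sides are saturated by `x`. Modulo `x` these
ideals have generators of `y`-degrees `0, b₁, 2 b₁, …`, like the generators of a monomial staircase
ideal, and the syzygies between consecutive generators lift (`Slice.mem_of_x_mul_mem`,
`MatrixData.Adapted.mem_symbolicIdealOne_of_x_mul_mem` and its analogue for `symbolicIdealTwo`).

Finally `d (j + 2) ≡ f * d j` modulo `𝔪 (g, h)^(j+1)`, which gives `d j ∈ P^((j+1)/2)` for odd `j` and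
`d j ∈ 𝔪 P^(j/2)` for even `j`; with the analogous formula for `e`, the displayed ideals lie in
`𝔪 P ^ n`.
-/

/-! ### Identities between the distinguished elements -/

namespace SpaceMonomialCurve

/-- Monomials from which the matrix with rows `ξ, Y, Γ Δ ζ ^ q` and `ζ, σ ξ ^ q, Y` is built,
where `ξ = σ τ` and `ζ = A Δ`. For the matrix of a curve of type `1'`, `q = ⌊a₂ / a₁⌋`, `ξ = x ^ a₁`,
`ζ = z ^ c₂` and `Y = y ^ b₁`; the factor `σ` is `x` to the remainder of `a₂` modulo `a₁`, and
`Γ Δ` is `z ^ (c₁ - q c₂)`. The common factor `Δ` of `Γ Δ` and `ζ` is split off, so that one of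
`A` and `Γ` is `1`; this makes the element `e` below uniform in the sign of `c₁ - (q + 1) c₂`. -/
structure MatrixData (R : Type*) where
  Y : R
  σ : R
  τ : R
  A : R
  Δ : R
  Γ : R
  q : ℕ

namespace MatrixData

variable {R : Type*} [CommRing R] (D : MatrixData R)

/-- The upper left entry `x ^ a₁`. -/
def ξ : R := D.σ * D.τ
/-- The lower left entry `z ^ c₂`. -/
def ζ : R := D.A * D.Δ
/-- The minor of the last two columns. -/
def f : R := D.Y ^ 2 - D.σ * D.ξ ^ D.q * (D.Γ * D.Δ * D.ζ ^ D.q)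
/-- The negative of the minor of the outer columns. -/
def g : R := D.Γ * D.Δ * D.ζ ^ (D.q + 1) - D.ξ * D.Y
/-- The minor of the first two columns. -/
def h : R := D.σ * D.ξ ^ (D.q + 1) - D.Y * D.ζ

/-- The homogeneous sum `∑ t ≤ j, (ζ g) ^ t (ξ h) ^ (j - t)`, in recursive form. -/
def T : ℕ → R
  | 0 => 1
  | j + 1 => D.ζ * D.g * T j + (D.ξ * D.h) ^ (j + 1)

/-- The distinguished elements: `d 1 = f`, and for `j ≤ q + 1` the element `d j` lies in the `j`-th
symbolic power and agrees with `± Y ^ (j + 1)` up to lower terms in `y` modulo `x`. The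
formula is obtained from `ξ d (j + 1) = d j * g - Γ Δ ζ ^ (q - j) h ^ (j + 1)` by dividing by `ξ`.
Only the indices `j ≤ q + 1` are meaningful, since `q - j` is truncated. -/
def d : ℕ → R
  | 0 => -D.Y
  | j + 1 => -D.Y * d j - D.Γ * D.Δ * D.σ * (D.ξ * D.ζ) ^ (D.q - j) * D.T j

/-- The extra element of the symbolic power of order `q + 2`: what remains of
`A d (q + 1) g - Γ h ^ (q + 2)` after division by `σ`. -/
def e : R := -(D.A * D.τ * D.Y * D.d (D.q + 1)) - D.Γ * D.T (D.q + 1)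

theorem T_succ (j : ℕ) : D.T (j + 1) = D.ζ * D.g * D.T j + (D.ξ * D.h) ^ (j + 1) := rfl

theorem d_succ (j : ℕ) :
    D.d (j + 1) = -D.Y * D.d j - D.Γ * D.Δ * D.σ * (D.ξ * D.ζ) ^ (D.q - j) * D.T j := rfl

/-- The other recursion for `T`, expressing its symmetry in `ζ g` and `ξ h`. -/
theorem T_succ' (j : ℕ) : D.T (j + 1) = D.ξ * D.h * D.T j + (D.ζ * D.g) ^ (j + 1) := by
  induction j with
  | zero => simp only [T]; ring
  | succ j ih =>
    rw [T_succ]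
    linear_combination (D.ζ * D.g) * ih - D.ξ * D.h * D.T_succ j

theorem d_one : D.d 1 = D.f := by
  simp only [d, T, f, Nat.sub_zero]; ring

theorem Y_mul_g : D.Y * D.g = -(D.ξ * D.f + D.Γ * D.Δ * D.ζ ^ D.q * D.h) := by
  simp only [f, g, h]; ring

theorem Y_mul_h : D.Y * D.h = -(D.ζ * D.f + D.σ * D.ξ ^ D.q * D.g) := by
  simp only [f, g, h]; ring

/-- Each of the two formulas for `j + 1` uses the other one for `j`, so they are proved together.
The second one exhibits a power of `x` times `d j` as a form of degree `j` in `g` and `h`. -/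
theorem pow_mul_d_aux (j : ℕ) (hj : j ≤ D.q + 1) :
    D.ζ ^ (j + 1) * D.d j = D.h ^ (j + 1) - D.σ * D.ξ ^ (D.q + 1 - j) * D.T j ∧
    D.ξ ^ (j + 1) * D.d j = D.g ^ (j + 1) - D.Γ * D.Δ * D.ζ ^ (D.q + 1 - j) * D.T j := by
  induction j with
  | zero => constructor <;> simp only [d, T, g, h, Nat.sub_zero] <;> ring
  | succ j ih =>
    obtain ⟨ih₁, ih₂⟩ := ih (by omega)
    obtain ⟨t, ht⟩ : ∃ t, D.q = j + t := ⟨D.q - j, by omega⟩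
    have e₁ : D.q + 1 - j = t + 1 := by omega
    have e₂ : D.q + 1 - (j + 1) = t := by omega
    have e₃ : D.q - j = t := by omega
    have hg : D.g = D.Γ * D.Δ * D.ζ ^ (j + t + 1) - D.ξ * D.Y := by rw [g, ht]
    have hh : D.h = D.σ * D.ξ ^ (j + t + 1) - D.Y * D.ζ := by rw [h, ht]
    rw [e₁] at ih₁ ih₂
    have h₁ : D.ξ * D.d (j + 1) = D.d j * D.g - D.Γ * D.Δ * D.ζ ^ t * D.h ^ (j + 1) := by
      rw [d_succ, e₃]
      linear_combination (-D.d j) * hg - (D.Γ * D.Δ * D.ζ ^ t) * ih₁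
    have h₂ : D.ζ * D.d (j + 1) = D.d j * D.h - D.σ * D.ξ ^ t * D.g ^ (j + 1) := by
      rw [d_succ, e₃]
      linear_combination (-D.d j) * hh - (D.σ * D.ξ ^ t) * ih₂
    rw [e₂]
    constructor
    · rw [T_succ']
      linear_combination D.ζ ^ (j + 1) * h₂ + D.h * ih₁
    · rw [T_succ]
      linear_combination D.ξ ^ (j + 1) * h₁ + D.g * ih₂

theorem ζ_pow_mul_d {j : ℕ} (hj : j ≤ D.q + 1) :
    D.ζ ^ (j + 1) * D.d j = D.h ^ (j + 1) - D.σ * D.ξ ^ (D.q + 1 - j) * D.T j :=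
  (D.pow_mul_d_aux j hj).1

theorem ξ_pow_mul_d {j : ℕ} (hj : j ≤ D.q + 1) :
    D.ξ ^ (j + 1) * D.d j = D.g ^ (j + 1) - D.Γ * D.Δ * D.ζ ^ (D.q + 1 - j) * D.T j :=
  (D.pow_mul_d_aux j hj).2

theorem d_mul_g {j : ℕ} (hj : j ≤ D.q) :
    D.d j * D.g = D.ξ * D.d (j + 1) + D.Γ * D.Δ * D.ζ ^ (D.q - j) * D.h ^ (j + 1) := by
  obtain ⟨t, ht⟩ : ∃ t, D.q = j + t := ⟨D.q - j, by omega⟩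
  have h₁ := D.ζ_pow_mul_d (j := j) (by omega)
  rw [show D.q + 1 - j = t + 1 by omega] at h₁
  have hg : D.g = D.Γ * D.Δ * D.ζ ^ (j + t + 1) - D.ξ * D.Y := by rw [g, ht]
  rw [d_succ, show D.q - j = t by omega]
  linear_combination D.d j * hg + (D.Γ * D.Δ * D.ζ ^ t) * h₁

theorem d_mul_h {j : ℕ} (hj : j ≤ D.q) :
    D.d j * D.h = D.ζ * D.d (j + 1) + D.σ * D.ξ ^ (D.q - j) * D.g ^ (j + 1) := by
  obtain ⟨t, ht⟩ : ∃ t, D.q = j + t := ⟨D.q - j, by omega⟩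
  have h₁ := D.ξ_pow_mul_d (j := j) (by omega)
  rw [show D.q + 1 - j = t + 1 by omega] at h₁
  have hh : D.h = D.σ * D.ξ ^ (j + t + 1) - D.Y * D.ζ := by rw [h, ht]
  rw [d_succ, show D.q - j = t by omega]
  linear_combination D.d j * hh + (D.σ * D.ξ ^ t) * h₁

theorem σ_mul_e : D.σ * D.e = D.A * D.d (D.q + 1) * D.g - D.Γ * D.h ^ (D.q + 2) := by
  have h₁ := D.ζ_pow_mul_d (j := D.q + 1) le_rfl
  rw [Nat.sub_self, pow_zero] at h₁
  have hg : D.g = D.Γ * D.Δ * D.ζ ^ (D.q + 1) - D.ξ * D.Y := rfl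
  have hξ : D.ξ = D.σ * D.τ := rfl
  have hζ : D.ζ = D.A * D.Δ := rfl
  rw [e]
  linear_combination (-D.A * D.d (D.q + 1)) * hg - D.Γ * h₁
    + (D.A * D.Y * D.d (D.q + 1)) * hξ
    + (D.Γ * D.ζ ^ (D.q + 1) * D.d (D.q + 1)) * hζ

theorem Δ_mul_e : D.Δ * D.e = D.τ * D.d (D.q + 1) * D.h - D.g ^ (D.q + 2) := by
  have h₁ := D.ξ_pow_mul_d (j := D.q + 1) le_rfl
  rw [Nat.sub_self, pow_zero] at h₁
  have hh : D.h = D.σ * D.ξ ^ (D.q + 1) - D.Y * D.ζ := rfl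
  have hξ : D.ξ = D.σ * D.τ := rfl
  have hζ : D.ζ = D.A * D.Δ := rfl
  rw [e]
  linear_combination (-D.τ * D.d (D.q + 1)) * hh - h₁
    + (D.τ * D.Y * D.d (D.q + 1)) * hζ
    + (D.ξ ^ (D.q + 1) * D.d (D.q + 1)) * hξ

theorem Y_mul_h_pow :
    D.Y * D.h ^ (D.q + 1) = -(D.ζ ^ (D.q + 1) * D.d (D.q + 1)) - D.σ * D.g * D.T D.q := by
  have h₁ := D.ζ_pow_mul_d (j := D.q) (by omega)
  rw [Nat.add_sub_cancel_left, pow_one] at h₁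
  have hg : D.g = D.Γ * D.Δ * D.ζ ^ (D.q + 1) - D.ξ * D.Y := rfl
  have hd := D.d_succ D.q
  rw [Nat.sub_self, pow_zero] at hd
  linear_combination (-D.Y) * h₁ + D.ζ ^ (D.q + 1) * hd + D.σ * D.T D.q * hg

/-- The formula that shows how deep `e` lies in the ordinary powers of the ideal of minors. -/
theorem e_eq :
    D.e = D.A * D.τ * D.f * D.d D.q - D.Γ * (D.ζ * D.g + D.ξ * D.h) * D.T D.q := by
  have h₁ := D.ζ_pow_mul_d (j := D.q) (by omega)
  rw [Nat.add_sub_cancel_left, pow_one] at h₁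
  have hd := D.d_succ D.q
  rw [Nat.sub_self, pow_zero] at hd
  have hh : D.h = D.σ * D.ξ ^ (D.q + 1) - D.Y * D.ζ := rfl
  have hf : D.f = D.Y ^ 2 - D.σ * D.ξ ^ D.q * (D.Γ * D.Δ * D.ζ ^ D.q) := rfl
  have hξ : D.ξ = D.σ * D.τ := rfl
  have hζ : D.ζ = D.A * D.Δ := rfl
  rw [e, T_succ]
  linear_combination (-D.A * D.τ * D.Y) * hd - D.A * D.τ * D.d D.q * hf
    + D.Γ * D.ξ ^ (D.q + 1) * h₁ + D.Γ * D.ξ * D.T D.q * hh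
    - (D.Γ * D.A * D.Δ * D.ξ ^ D.q * D.ζ ^ D.q * D.d D.q + D.Y * D.A * D.Γ * D.Δ * D.T D.q) * hξ
    - (D.Γ * D.ξ ^ (D.q + 1) * D.ζ ^ D.q * D.d D.q + D.Y * D.Γ * D.ξ * D.T D.q) * hζ

/-- The lift of the first syzygy of the staircase of `symbolicIdealOne`. -/
theorem Y_mul_e :
    D.Y * D.e = -(D.A * D.τ * D.d (D.q + 1) * D.f) + D.Γ * D.g * D.h * D.T D.q := by
  have hd := D.d_succ D.q
  rw [Nat.sub_self, pow_zero] at hd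
  have h₁ := D.ζ_pow_mul_d (j := D.q) (by omega)
  rw [Nat.add_sub_cancel_left, pow_one] at h₁
  have hh : D.h = D.σ * D.ξ ^ (D.q + 1) - D.Y * D.ζ := rfl
  have hg : D.g = D.Γ * D.Δ * D.ζ ^ (D.q + 1) - D.ξ * D.Y := rfl
  have hf : D.f = D.Y ^ 2 - D.σ * D.ξ ^ D.q * (D.Γ * D.Δ * D.ζ ^ D.q) := rfl
  have hξ : D.ξ = D.σ * D.τ := rfl
  have hζ : D.ζ = D.A * D.Δ := rfl
  have h₄ := D.d_mul_g (j := D.q) le_rfl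
  rw [Nat.sub_self, pow_zero] at h₄
  have key : D.ξ ^ (D.q + 1) * D.ζ ^ (D.q + 1) * D.d (D.q + 1) + D.Y * D.T (D.q + 1)
      = -(D.g * D.h * D.T D.q) := by
    rw [T_succ]
    linear_combination (-D.ζ ^ (D.q + 1) * D.ξ ^ D.q) * h₄ + D.g * D.ξ ^ D.q * h₁
      + D.ξ ^ D.q * D.h ^ (D.q + 1) * hg + D.g * D.T D.q * hh
  rw [e]
  linear_combination (-D.Γ) * key + D.A * D.τ * D.d (D.q + 1) * hf
    + D.A * D.Γ * D.Δ * D.ξ ^ D.q * D.ζ ^ D.q * D.d (D.q + 1) * hξ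
    + D.Γ * D.ξ ^ (D.q + 1) * D.ζ ^ D.q * D.d (D.q + 1) * hζ

/-- Up to forms in `g` and `h` with coefficients in the maximal ideal, passing from `d j` to
`d (j + 2)` is multiplication by `f`. -/
theorem d_add_two {j : ℕ} (hj : j + 1 ≤ D.q) :
    D.d (j + 2) = D.f * D.d j
      - D.Γ * D.Δ * D.σ * (D.ξ * D.ζ) ^ (D.q - (j + 1)) * (D.ζ * D.g + D.ξ * D.h) * D.T j := by
  obtain ⟨t, ht⟩ : ∃ t, D.q = j + 1 + t := ⟨D.q - (j + 1), by omega⟩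
  have h₁ := D.ζ_pow_mul_d (j := j) (by omega)
  rw [show D.q + 1 - j = t + 2 by omega] at h₁
  have hh : D.h = D.σ * D.ξ ^ (j + 1 + t + 1) - D.Y * D.ζ := by rw [h, ht]
  have hf : D.f = D.Y ^ 2 - D.σ * D.ξ ^ (j + 1 + t) * (D.Γ * D.Δ * D.ζ ^ (j + 1 + t)) := by
    rw [f, ht]
  rw [d_succ, d_succ, T_succ, show D.q - (j + 1) = t by omega, show D.q - j = t + 1 by omega]
  linear_combination (-D.d j) * hf + D.Γ * D.Δ * D.σ * D.ξ ^ (t + j + 1) * D.ζ ^ t * h₁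
    + D.Γ * D.Δ * D.σ * D.ξ ^ (t + 1) * D.ζ ^ t * D.T j * hh

end MatrixData
end SpaceMonomialCurve

/-! ### Symbolic powers and saturation -/

namespace SpaceMonomialCurve

section PairPowers

variable {R : Type*} [CommRing R]

theorem mul_pow_mem_span_pair_pow {g h : R} (i j : ℕ) {n : ℕ} (hn : i + j = n) :
    g ^ i * h ^ j ∈ Ideal.span {g, h} ^ n := by
  rw [← hn, pow_add]
  exact Ideal.mul_mem_mul (Ideal.pow_mem_pow (Ideal.subset_span (by simp)) _)
    (Ideal.pow_mem_pow (Ideal.subset_span (by simp)) _)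

theorem exists_of_mem_span_pair_pow_succ {g h : R} {n : ℕ} {v : R}
    (hv : v ∈ Ideal.span {g, h} ^ (n + 1)) :
    ∃ w ∈ Ideal.span {g, h} ^ n, ∃ α, v = g * w + α * h ^ (n + 1) := by
  induction n generalizing v with
  | zero =>
    rw [zero_add, pow_one] at hv
    obtain ⟨a, b, rfl⟩ := Ideal.mem_span_pair.1 hv
    exact ⟨a, by simp, b, by ring⟩
  | succ n ih =>
    rw [pow_succ] at hv
    refine Submodule.mul_induction_on hv ?_ ?_
    · intro v hv t ht
      obtain ⟨w, hw, α, rfl⟩ := ih hv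
      obtain ⟨a, b, rfl⟩ := Ideal.mem_span_pair.1 ht
      refine ⟨w * (a * g + b * h) + α * a * h ^ (n + 1), add_mem ?_ ?_, α * b, by ring⟩
      · rw [pow_succ]
        exact Ideal.mul_mem_mul hw ht
      · refine Ideal.mul_mem_left _ _ ?_
        simpa using mul_pow_mem_span_pair_pow (g := g) (h := h) 0 (n + 1) (zero_add _)
    · rintro _ _ ⟨w, hw, α, rfl⟩ ⟨w', hw', α', rfl⟩
      exact ⟨w + w', add_mem hw hw', α + α', by ring⟩

theorem span_pair_pow_le {g h : R} {n : ℕ} {K : Ideal R}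
    (hK : ∀ i j, i + j = n → g ^ i * h ^ j ∈ K) : Ideal.span {g, h} ^ n ≤ K := by
  suffices H : ∀ (n : ℕ) (c v : R), v ∈ Ideal.span {g, h} ^ n →
      (∀ i j, i + j = n → g ^ i * h ^ j * c ∈ K) → v * c ∈ K by
    intro v hv
    simpa using H n 1 v hv (by simpa using hK)
  intro n
  induction n with
  | zero =>
    intro c v _ hc
    exact K.mul_mem_left _ (by simpa using hc 0 0 rfl)
  | succ n ih =>
    intro c v hv hc
    obtain ⟨w, hw, α, rfl⟩ := exists_of_mem_span_pair_pow_succ hv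
    have h₁ : w * (g * c) ∈ K := by
      refine ih _ _ hw fun i j hij => ?_
      have := hc (i + 1) j (by omega)
      rwa [show g ^ i * h ^ j * (g * c) = g ^ (i + 1) * h ^ j * c by ring]
    have h₂ : α * (h ^ (n + 1) * c) ∈ K :=
      K.mul_mem_left _ (by simpa using hc 0 (n + 1) (by omega))
    rw [show (g * w + α * h ^ (n + 1)) * c = w * (g * c) + α * (h ^ (n + 1) * c) by ring]
    exact add_mem h₁ h₂

/-- The regular sequence `g, h` is quasi-regular: if `v` is a form of degree `n` in `g` and `h`
and `s * v` has order `n + 1`, then the coefficients of `v` are killed by `s` modulo `(g, h)`, so they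
lie in `P`, and multiplication by `x` moves them into `(g, h)`. -/
theorem mul_mem_span_pair_pow_succ [IsDomain R] {g h x s : R} {P : Ideal R} [P.IsPrime]
    (hg : g ≠ 0) (hgh : ∀ α, g ∣ α * h → g ∣ α) (hgP : g ∈ P) (hhP : h ∈ P)
    (hx : ∀ α ∈ P, x * α ∈ Ideal.span {g, h}) (hs : s ∉ P) {n : ℕ} {v : R}
    (hv : v ∈ Ideal.span {g, h} ^ n) (hsv : s * v ∈ Ideal.span {g, h} ^ (n + 1)) :
    x * v ∈ Ideal.span {g, h} ^ (n + 1) := by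
  have hgpow : ∀ (m : ℕ) α, g ∣ α * h ^ m → g ∣ α := by
    intro m
    induction m with
    | zero => intro α; simp
    | succ m ih => exact fun α hα => ih α (hgh _ (by rwa [mul_assoc, ← pow_succ]))
  have hIP : Ideal.span {g, h} ≤ P := by
    rw [Ideal.span_le]; rintro _ (rfl | rfl) <;> assumption
  induction n generalizing v with
  | zero =>
    rw [zero_add, pow_one] at hsv ⊢
    exact hx _ ((Ideal.IsPrime.mem_or_mem ‹_› (hIP hsv)).resolve_left hs)
  | succ n ih =>
    obtain ⟨w, hw, α, rfl⟩ := exists_of_mem_span_pair_pow_succ hv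
    obtain ⟨w', hw', β, hβ⟩ := exists_of_mem_span_pair_pow_succ hsv
    have hdvd : g ∣ (β * h - s * α) * h ^ (n + 1) := ⟨s * w - w', by linear_combination -hβ⟩
    obtain ⟨κ, hκ⟩ := hgpow _ _ hdvd
    have hα : x * α ∈ Ideal.span {g, h} := by
      refine hx _ ((Ideal.IsPrime.mem_or_mem ‹_› (?_ : s * α ∈ P)).resolve_left hs)
      rw [show s * α = β * h - g * κ by linear_combination -hκ]
      exact sub_mem (P.mul_mem_left _ hhP) (P.mul_mem_right _ hgP)
    have hsw : s * w = w' + κ * h ^ (n + 1) := by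
      refine mul_left_cancel₀ hg ?_
      linear_combination hβ + h ^ (n + 1) * hκ
    have hw₁ : x * w ∈ Ideal.span {g, h} ^ (n + 1) := by
      refine ih hw ?_
      rw [hsw]
      refine add_mem hw' (Ideal.mul_mem_left _ _ ?_)
      simpa using mul_pow_mem_span_pair_pow (g := g) (h := h) 0 (n + 1) (zero_add _)
    rw [show x * (g * w + α * h ^ (n + 1)) = (x * w) * g + (h ^ (n + 1)) * (x * α) by ring]
    rw [pow_succ _ (n + 1)]
    refine add_mem (Ideal.mul_mem_mul hw₁ (Ideal.subset_span (by simp)))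
      (Ideal.mul_mem_mul ?_ hα)
    simpa using mul_pow_mem_span_pair_pow (g := g) (h := h) 0 (n + 1) (zero_add _)

end PairPowers

section Symbolic

variable {R : Type*} [CommRing R]

theorem mem_symbolicPower_iff {P : Ideal R} [P.IsPrime] {n : ℕ} {u : R} :
    u ∈ symbolicPower P n ↔ ∃ s ∉ P, s * u ∈ P ^ n := by
  rw [symbolicPower, Ideal.mem_comap,
    IsLocalization.algebraMap_mem_map_algebraMap_iff P.primeCompl]
  rfl

/-- If `P` becomes the complete intersection `(g, h)` after inverting `x`, then `P^(n)` is the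
saturation of `(g, h)^n` by `x`; hence it lies in each ideal that contains `(g, h)^n` and is
saturated by `x`. -/
theorem symbolicPower_le_of_span_pair_pow_le [IsDomain R] {g h x : R} {P : Ideal R} [P.IsPrime]
    (hg : g ≠ 0) (hgh : ∀ α, g ∣ α * h → g ∣ α) (hgP : g ∈ P) (hhP : h ∈ P)
    {a : ℕ} (hx : ∀ α ∈ P, x ^ a * α ∈ Ideal.span {g, h}) (hxP : x ∉ P) {n : ℕ} {J : Ideal R}
    (hJ : Ideal.span {g, h} ^ n ≤ J) (hxJ : ∀ w, x * w ∈ J → w ∈ J) :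
    symbolicPower P n ≤ J := by
  intro u hu
  obtain ⟨s, hs, hsu⟩ := mem_symbolicPower_iff.1 hu
  have hPI : Ideal.span {x ^ a} * P ≤ Ideal.span {g, h} := by
    rw [Ideal.span_singleton_mul_le_iff]
    exact hx
  have hsu' : x ^ (a * n) * s * u ∈ Ideal.span {g, h} ^ n := by
    have h₁ := Ideal.pow_right_mono hPI n
    rw [mul_pow, Ideal.span_singleton_pow, Ideal.span_singleton_mul_le_iff, ← pow_mul] at h₁
    rw [mul_assoc]
    exact h₁ _ hsu
  have hs' : x ^ (a * n) * s ∉ P := fun hmem =>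
    (Ideal.IsPrime.mem_or_mem ‹_› hmem).elim
      (fun h' => hxP (Ideal.IsPrime.mem_of_pow_mem ‹_› _ h')) hs
  generalize x ^ (a * n) * s = s' at hsu' hs'
  have key : ∀ i ≤ n, ∃ N, x ^ N * u ∈ Ideal.span {g, h} ^ i := by
    intro i
    induction i with
    | zero => exact fun _ => ⟨0, by simp⟩
    | succ i ih =>
      intro hi
      obtain ⟨N, hN⟩ := ih (by omega)
      refine ⟨a + N, ?_⟩
      rw [pow_add x, mul_assoc]
      refine mul_mem_span_pair_pow_succ hg hgh hgP hhP hx hs' hN ?_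
      rw [mul_left_comm]
      exact Ideal.mul_mem_left _ _ (Ideal.pow_le_pow_right hi hsu')
  obtain ⟨N, hN⟩ := key n le_rfl
  have hNJ := hJ hN
  clear hN
  induction N with
  | zero => simpa using hNJ
  | succ N ih => exact ih (hxJ _ (by rwa [← mul_assoc, ← pow_succ']))

end Symbolic

section Slice

open Polynomial

/-- An identification of `R / (x)`, with `x` a nonzerodivisor, with the polynomial ring `B[y]`,
together with lifts to `R` of the scalars `B` and of the variable `y`. -/
structure Slice (R B : Type*) [CommRing R] [CommRing B] where
  x : R
  y : R
  c : B →+* R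
  π : R →+* B[X]
  π_c : ∀ β, π (c β) = C β
  π_y : π y = X
  π_x : π x = 0
  dvd_of_π_eq_zero : ∀ w, π w = 0 → x ∣ w
  mul_left_cancel : ∀ v w, x * v = x * w → v = w

/-- Polynomials of degrees `0, b, 2 b, …, L b` admit no relation whose coefficients, other than
the last, have degree less than `b`: the degree ranges of the summands are disjoint. -/
theorem eq_zero_of_sum_staircase {B : Type*} [CommRing B] [IsDomain B] {b : ℕ} {L : ℕ}
    {v : ℕ → B[X]} (hv : ∀ k ≤ L, (v k).degree = (b * k : ℕ)) {γ : ℕ → B[X]}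
    (hγ : ∀ k < L, (γ k).degree < b) {ρ : B[X]}
    (hsum : ∑ k ∈ Finset.range L, γ k * v k + ρ * v L = 0) :
    (∀ k < L, γ k = 0) ∧ ρ = 0 := by
  have hlt : ∀ k < L, (γ k * v k).degree < (b * (k + 1) : ℕ) := by
    intro k hk
    rw [degree_mul, hv k hk.le]
    have := hγ k hk
    rcases eq_or_ne (γ k) 0 with h0 | h0
    · rw [h0, degree_zero, WithBot.bot_add]
      exact WithBot.bot_lt_coe _
    · rw [degree_eq_natDegree h0] at this ⊢
      have h' : (γ k).natDegree < b := by exact_mod_cast this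
      have : (γ k).natDegree + b * k < b * (k + 1) := by rw [mul_add]; omega
      exact_mod_cast this
  have hdeg : ∀ n ≤ L, (∑ k ∈ Finset.range n, γ k * v k).degree < (b * n : ℕ) := by
    intro n hn
    refine (Polynomial.degree_sum_le _ _).trans_lt ?_
    refine (Finset.sup_lt_iff (WithBot.bot_lt_coe _)).2 fun k hk => ?_
    have hk' := Finset.mem_range.1 hk
    refine (hlt k (by omega)).trans_le ?_
    exact_mod_cast Nat.mul_le_mul_left b (by omega)
  have hvne : ∀ k ≤ L, v k ≠ 0 := by
    intro k hk h0
    have := hv k hk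
    rw [h0, degree_zero] at this
    exact WithBot.coe_ne_bot this.symm
  have haux : ∀ n ≤ L, ∀ ρ : B[X], ∑ k ∈ Finset.range n, γ k * v k + ρ * v n = 0 → ρ = 0 := by
    intro n hn ρ h0
    by_contra hρ
    have h₁ : (ρ * v n).degree < (b * n : ℕ) := by
      rw [eq_neg_of_add_eq_zero_right h0, degree_neg]
      exact hdeg n hn
    rw [degree_mul, hv n hn, degree_eq_natDegree hρ] at h₁
    have : ρ.natDegree + b * n < b * n := by exact_mod_cast h₁
    omega
  have hρ := haux L le_rfl ρ hsum
  refine ⟨?_, hρ⟩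
  rw [hρ, zero_mul, add_zero] at hsum
  clear hρ
  have hall : ∀ n ≤ L, ∑ k ∈ Finset.range n, γ k * v k = 0 → ∀ k < n, γ k = 0 := by
    intro n
    induction n with
    | zero => intro _ _ k hk; omega
    | succ n ih =>
      intro hn h0 k hk
      rw [Finset.sum_range_succ] at h0
      have hz := haux n (by omega) _ h0
      rcases Nat.lt_succ_iff_lt_or_eq.1 hk with h' | rfl
      · rw [hz, zero_mul, add_zero] at h0
        exact ih (by omega) h0 k h'
      · exact hz
  exact hall L le_rfl hsum

namespace Slice

variable {R B : Type*} [CommRing R] [CommRing B] (S : Slice R B)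

/-- The ring homomorphism `B[y] → R` that splits the projection `π`. -/
noncomputable def lift : B[X] →+* R := eval₂RingHom S.c S.y

theorem lift_C (β : B) : S.lift (C β) = S.c β := by simp [lift]

theorem lift_X : S.lift X = S.y := by simp [lift]

theorem π_lift (p : B[X]) : S.π (S.lift p) = p := by
  have : S.π.comp S.lift = RingHom.id _ := by
    ext
    · simp [lift_C, S.π_c]
    · simp [lift_X, S.π_y]
  exact congrArg (fun φ : B[X] →+* B[X] => φ p) this

theorem exists_eq_lift_add (w : R) : ∃ w', w = S.lift (S.π w) + S.x * w' := by
  obtain ⟨w', hw'⟩ := S.dvd_of_π_eq_zero (w - S.lift (S.π w)) (by simp [π_lift])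
  exact ⟨w', by linear_combination hw'⟩

/-- The combinations of `u 0, …, u L` whose coefficients, other than that of `u L`, are scalars,
up to elements of `x J`. -/
def relationGroup (u : ℕ → R) (L : ℕ) (J : Ideal R) : AddSubgroup R :=
  AddSubgroup.closure {v | ∃ β : B, ∃ k < L, v = S.c β * u k} ⊔
    (Ideal.span {u L} ⊔ Ideal.span {S.x} * J).toAddSubgroup

variable {S} in
theorem c_mul_mem_relationGroup {u : ℕ → R} {L : ℕ} {J : Ideal R} (β : B) {k : ℕ} (hk : k ≤ L) :
    S.c β * u k ∈ S.relationGroup u L J := by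
  rcases hk.lt_or_eq with h | rfl
  · exact AddSubgroup.mem_sup_left (AddSubgroup.subset_closure ⟨β, k, h, rfl⟩)
  · refine AddSubgroup.mem_sup_right ?_
    exact Ideal.mem_sup_left (Ideal.mul_mem_left _ _ (Ideal.subset_span rfl))

variable {S} in
theorem mul_last_mem_relationGroup {u : ℕ → R} {L : ℕ} {J : Ideal R} (ρ : R) :
    ρ * u L ∈ S.relationGroup u L J :=
  AddSubgroup.mem_sup_right (Ideal.mem_sup_left (Ideal.mul_mem_left _ _ (Ideal.subset_span rfl)))

variable {S} in
theorem x_mul_mem_relationGroup {u : ℕ → R} {L : ℕ} {J : Ideal R} {w r : R} (hr : S.x ∣ r)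
    (hw : w ∈ J) : r * w ∈ S.relationGroup u L J := by
  obtain ⟨r, rfl⟩ := hr
  refine AddSubgroup.mem_sup_right (Ideal.mem_sup_right ?_)
  rw [mul_assoc]
  exact Ideal.mul_mem_mul (Ideal.subset_span rfl) (J.mul_mem_left _ hw)

/-- A saturation criterion. Let `J` be generated by `u 0, …, u L`, whose restrictions to `x = 0`
have degrees `0, b, …, L b` in `y`. If each `y ^ b * u k` with `k < L` is, modulo `x J`, a
combination as in `relationGroup`, then the syzygies of the restrictions lift, and `J` is saturated
by `x`. -/
theorem mem_of_x_mul_mem [IsDomain B] {u : ℕ → R} {L b : ℕ} {J : Ideal R} (hb : 0 < b)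
    (huJ : ∀ k ≤ L, u k ∈ J) (hJ : J ≤ Ideal.span {v | ∃ k ≤ L, v = u k})
    (hdeg : ∀ k ≤ L, (S.π (u k)).degree = (b * k : ℕ))
    (hrel : ∀ k < L, S.y ^ b * u k ∈ S.relationGroup u L J)
    {w : R} (hw : S.x * w ∈ J) : w ∈ J := by
  -- `N` consists of the combinations whose coefficients are reduced modulo `y ^ b`.
  let N : R → Prop := fun v => ∃ γ : ℕ → B[X], (∀ k < L, (γ k).degree < b) ∧ ∃ ρ : R, ∃ j ∈ J,
    v = ∑ k ∈ Finset.range L, S.lift (γ k) * u k + ρ * u L + S.x * j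
  have hNJ : ∀ {v}, N v → v ∈ J := by
    rintro v ⟨γ, -, ρ, j, hj, rfl⟩
    refine add_mem (add_mem (sum_mem fun k hk => ?_) ?_) (J.mul_mem_left _ hj)
    · exact J.mul_mem_left _ (huJ k (Finset.mem_range.1 hk).le)
    · exact J.mul_mem_left _ (huJ L le_rfl)
  have hNx : ∀ {v}, v ∈ J → N (S.x * v) := fun {v} hv =>
    ⟨0, fun k _ => by simp, 0, v, hv, by simp⟩
  have hNL : ∀ ρ, N (ρ * u L) := fun ρ => ⟨0, fun k _ => by simp, ρ, 0, J.zero_mem, by simp⟩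
  have hNadd : ∀ {v v'}, N v → N v' → N (v + v') := by
    rintro _ _ ⟨γ, hγ, ρ, j, hj, rfl⟩ ⟨γ', hγ', ρ', j', hj', rfl⟩
    refine ⟨γ + γ', fun k hk => ?_, ρ + ρ', j + j', add_mem hj hj', ?_⟩
    · exact (degree_add_le _ _).trans_lt (max_lt (hγ k hk) (hγ' k hk))
    · simp only [Pi.add_apply, map_add, add_mul, Finset.sum_add_distrib]; ring
  have hNsum : ∀ (v : ℕ → R) (n : ℕ), (∀ k < n, N (v k)) → N (∑ k ∈ Finset.range n, v k) := by
    intro v n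
    induction n with
    | zero => intro _; simpa using hNx (J.zero_mem)
    | succ n ih =>
      intro hv
      rw [Finset.sum_range_succ]
      exact hNadd (ih fun k hk => hv k (by omega)) (hv n (by omega))
  have hNk : ∀ {k}, k < L → ∀ {p : B[X]}, p.degree < b → N (S.lift p * u k) := by
    intro k hk p hp
    refine ⟨fun i => if i = k then p else 0, fun i _ => ?_, 0, 0, J.zero_mem, ?_⟩
    · dsimp only
      split_ifs
      · exact hp
      · simp
    · simp [apply_ite S.lift, hk]
  have hNc : ∀ (β : B) {v}, N v → N (S.c β * v) := by
    rintro β _ ⟨γ, hγ, ρ, j, hj, rfl⟩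
    refine ⟨fun k => C β * γ k, fun k hk => ?_, S.c β * ρ, S.c β * j, J.mul_mem_left _ hj, ?_⟩
    · rw [degree_lt_iff_coeff_zero]
      intro m hm
      rw [coeff_C_mul, (degree_lt_iff_coeff_zero _ _).1 (hγ k hk) m hm, mul_zero]
    · simp only [map_mul, lift_C, mul_add, Finset.mul_sum, mul_assoc]
      ring
  have hNrel : ∀ {v}, v ∈ S.relationGroup u L J → N v := by
    intro v hv
    obtain ⟨v₁, hv₁, v₂, hv₂, rfl⟩ := AddSubgroup.mem_sup.1 hv
    refine hNadd ?_ ?_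
    · clear hv
      induction hv₁ using AddSubgroup.closure_induction with
      | mem v hv =>
        obtain ⟨β, k, hk, rfl⟩ := hv
        rw [← lift_C]
        exact hNk hk (degree_C_le.trans_lt (by exact_mod_cast hb))
      | zero => simpa using hNx (J.zero_mem)
      | add v v' _ _ ih ih' => exact hNadd ih ih'
      | neg v _ ih => simpa using hNc (-1) ih
    · obtain ⟨v₃, hv₃, v₄, hv₄, rfl⟩ := Submodule.mem_sup.1 hv₂
      obtain ⟨ρ, rfl⟩ := Ideal.mem_span_singleton'.1 hv₃
      obtain ⟨j, hj, rfl⟩ := Ideal.mem_span_singleton_mul.1 hv₄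
      exact hNadd (hNL ρ) (hNx hj)
  have hNy : ∀ {v}, N v → N (S.y * v) := by
    rintro _ ⟨γ, hγ, ρ, j, hj, rfl⟩
    rw [mul_add, mul_add, Finset.mul_sum]
    refine hNadd (hNadd (hNsum _ _ fun k hk => ?_) ?_) ?_
    · -- `X * γ = (X * γ - β X ^ b) + β X ^ b`, where `β` is the coefficient of `X ^ (b - 1)`.
      obtain ⟨b', rfl⟩ : ∃ b', b = b' + 1 := ⟨b - 1, by omega⟩
      have hlow : (X * γ k - C ((γ k).coeff b') * X ^ (b' + 1)).degree
          < ((b' + 1 : ℕ) : WithBot ℕ) := by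
        rw [degree_lt_iff_coeff_zero]
        intro m hm
        obtain ⟨m, rfl⟩ : ∃ m', m = m' + 1 := ⟨m - 1, by omega⟩
        rw [coeff_sub, coeff_X_mul, coeff_C_mul, coeff_X_pow]
        rcases eq_or_ne m b' with rfl | hne
        · simp
        · have : (γ k).coeff m = 0 :=
            (degree_lt_iff_coeff_zero _ _).1 (hγ k hk) m (by omega)
          simp [this, hne]
      have e : S.y * (S.lift (γ k) * u k) =
          S.lift (X * γ k - C ((γ k).coeff b') * X ^ (b' + 1)) * u k
          + S.c ((γ k).coeff b') * (S.y ^ (b' + 1) * u k) := by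
        simp only [map_sub, map_mul, map_pow, lift_C, lift_X]; ring
      rw [e]
      exact hNadd (hNk hk hlow) (hNc _ (hNrel (hrel k hk)))
    · rw [← mul_assoc]; exact hNL _
    · rw [mul_left_comm]; exact hNx (J.mul_mem_left _ hj)
  have hNlift : ∀ (p : B[X]) {v}, N v → N (S.lift p * v) := by
    intro p
    induction p using Polynomial.induction_on' with
    | add p p' ih ih' => intro v hv; rw [map_add, add_mul]; exact hNadd (ih hv) (ih' hv)
    | monomial m β =>
      intro v hv
      rw [← C_mul_X_pow_eq_monomial, map_mul, map_pow, lift_C, lift_X, mul_assoc]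
      refine hNc _ ?_
      induction m with
      | zero => simpa using hv
      | succ m ih => rw [pow_succ', mul_assoc]; exact hNy ih
  have hNmul : ∀ (r : R) {v}, N v → N (r * v) := by
    intro r v hv
    obtain ⟨r', hr'⟩ := S.exists_eq_lift_add r
    rw [hr', add_mul, mul_assoc]
    exact hNadd (hNlift _ hv) (hNx (J.mul_mem_left _ (hNJ hv)))
  have hNall : ∀ {v}, v ∈ J → N v := by
    intro v hv
    have hv' := hJ hv
    clear hv
    induction hv' using Submodule.span_induction with
    | mem v hv =>
      obtain ⟨k, hk, rfl⟩ := hv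
      rcases hk.lt_or_eq with h | rfl
      · simpa [lift] using hNk h (p := 1) (by
          rw [← C_1]; exact degree_C_le.trans_lt (by exact_mod_cast hb))
      · simpa using hNL 1
    | zero => simpa using hNx (J.zero_mem)
    | add v v' _ _ ih ih' => exact hNadd ih ih'
    | smul r v _ ih => exact hNmul r ih
  obtain ⟨γ, hγ, ρ, j, hj, he⟩ := hNall hw
  have hπ := congrArg S.π he
  simp only [map_add, map_mul, map_sum, S.π_x, zero_mul, add_zero, π_lift] at hπ
  obtain ⟨hγ0, hρ0⟩ := eq_zero_of_sum_staircase hdeg hγ hπ.symm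
  obtain ⟨ρ', rfl⟩ := S.dvd_of_π_eq_zero ρ hρ0
  rw [Finset.sum_eq_zero fun k hk => by rw [hγ0 k (Finset.mem_range.1 hk)]; simp] at he
  have : w = ρ' * u L + j := S.mul_left_cancel _ _ (by linear_combination he)
  rw [this]
  exact add_mem (J.mul_mem_left _ (huJ L le_rfl)) hj

end Slice
end Slice
end SpaceMonomialCurve

/-! ### Ideals and degrees attached to the data -/

namespace SpaceMonomialCurve

open Polynomial

namespace MatrixData

variable {R : Type*} [CommRing R] (D : MatrixData R)

/-- The complete intersection ideal `(g, h)`. -/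
def I : Ideal R := Ideal.span {D.g, D.h}

/-- The ideal `(f, g, h)` of the minors. -/
def minors : Ideal R := Ideal.span {D.f, D.g, D.h}

theorem g_mem_I : D.g ∈ D.I := Ideal.subset_span (by simp)
theorem h_mem_I : D.h ∈ D.I := Ideal.subset_span (by simp)
theorem f_mem_minors : D.f ∈ D.minors := Ideal.subset_span (by simp)
theorem I_le_minors : D.I ≤ D.minors := Ideal.span_mono (by simp)

theorem g_pow_mul_h_pow_mem (i j : ℕ) {n : ℕ} (hn : i + j = n) :
    D.g ^ i * D.h ^ j ∈ D.I ^ n := mul_pow_mem_span_pair_pow i j hn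

theorem T_mem (j : ℕ) : D.T j ∈ D.I ^ j := by
  induction j with
  | zero => simp
  | succ j ih =>
    rw [T_succ]
    refine add_mem ?_ (Ideal.pow_mem_pow (Ideal.mul_mem_left _ _ D.h_mem_I) _)
    rw [pow_succ', mul_assoc]
    exact Ideal.mul_mem_left _ _ (Ideal.mul_mem_mul D.g_mem_I ih)

theorem ξ_mul_mem_I {v : R} (hv : v ∈ D.minors) : D.ξ * v ∈ D.I := by
  suffices D.minors ≤ D.I.colon {D.ξ} by
    simpa [Submodule.mem_colon_singleton, mul_comm] using this hv
  rw [minors, Ideal.span_le]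
  have hf : D.f * D.ξ = -(D.Y * D.g) - D.Γ * D.Δ * D.ζ ^ D.q * D.h := by
    linear_combination D.Y_mul_g
  rintro _ (rfl | rfl | rfl) <;>
    simp only [SetLike.mem_coe, Submodule.mem_colon_singleton, smul_eq_mul]
  · rw [hf]
    exact sub_mem (neg_mem (Ideal.mul_mem_left _ _ D.g_mem_I)) (Ideal.mul_mem_left _ _ D.h_mem_I)
  · exact Ideal.mul_mem_right _ _ D.g_mem_I
  · exact Ideal.mul_mem_right _ _ D.h_mem_I

theorem d_mul_mem {j t : ℕ} (hjt : j + t ≤ D.q + 1) {v : R} (hv : v ∈ D.I ^ t) :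
    D.d j * v ∈ Ideal.span {D.d (j + t)} ⊔ D.I ^ (j + t) := by
  induction t generalizing v with
  | zero => exact Ideal.mem_sup_left (Ideal.mul_mem_right _ _ (Ideal.subset_span rfl))
  | succ t ih =>
    have hle : (Ideal.span {D.d (j + t)} ⊔ D.I ^ (j + t)) * D.I
        ≤ Ideal.span {D.d (j + (t + 1))} ⊔ D.I ^ (j + (t + 1)) := by
      rw [Ideal.sup_mul, ← pow_succ]
      refine sup_le ?_ le_sup_right
      rw [Ideal.span_singleton_mul_le_iff]
      intro z hz
      obtain ⟨a, b, rfl⟩ := Ideal.mem_span_pair.1 hz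
      have hg := D.d_mul_g (j := j + t) (by omega)
      have hh := D.d_mul_h (j := j + t) (by omega)
      have e : D.d (j + t) * (a * D.g + b * D.h)
          = (a * D.ξ + b * D.ζ) * D.d (j + t + 1)
            + (a * (D.Γ * D.Δ * D.ζ ^ (D.q - (j + t))) * D.h ^ (j + t + 1)
              + b * (D.σ * D.ξ ^ (D.q - (j + t))) * D.g ^ (j + t + 1)) := by
        linear_combination a * hg + b * hh
      rw [e]
      refine add_mem (Ideal.mem_sup_left (Ideal.mul_mem_left _ _ (Ideal.subset_span rfl)))
        (Ideal.mem_sup_right (add_mem ?_ ?_))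
      · exact Ideal.mul_mem_left _ _ (Ideal.pow_mem_pow D.h_mem_I _)
      · exact Ideal.mul_mem_left _ _ (Ideal.pow_mem_pow D.g_mem_I _)
    rw [pow_succ] at hv
    refine Submodule.mul_induction_on hv (fun v hv z hz => ?_) fun v v' ih ih' => ?_
    · rw [← mul_assoc]
      exact hle (Ideal.mul_mem_mul (ih (by omega) hv) hz)
    · rw [mul_add]; exact add_mem ih ih'

theorem f_mul_mem {v : R} (hv : v ∈ D.I ^ D.q) :
    D.f * v ∈ Ideal.span {D.d (D.q + 1)} ⊔ D.I ^ (D.q + 1) := by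
  rw [← d_one]
  have := D.d_mul_mem (j := 1) (t := D.q) (by omega) hv
  rwa [add_comm 1] at this

/-- Modulo `ξ` only the last summand of `T q` survives in `g h T q`. -/
theorem g_mul_h_mul_T (hq : 1 ≤ D.q) : ∃ w ∈ D.I ^ (D.q + 2),
    D.g * D.h * D.T D.q = D.ζ ^ D.q * (D.g ^ (D.q + 1) * D.h) + D.ξ * w := by
  obtain ⟨p, hp⟩ : ∃ p, D.q = p + 1 := ⟨D.q - 1, by omega⟩
  refine ⟨D.g ^ 1 * D.h ^ 2 * D.T p, ?_, ?_⟩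
  · rw [show D.q + 2 = 3 + p by omega, pow_add]
    exact Ideal.mul_mem_mul (D.g_pow_mul_h_pow_mem 1 2 rfl) (D.T_mem p)
  · have := D.T_succ' p
    rw [hp]
    linear_combination D.g * D.h * this

variable {B : Type*} [CommRing B] (S : Slice R B)

/-- The data are monomials with respect to a slice of `R` by `x`: `Y` is a power of `y`, the factors
`A`, `Γ`, `Δ` are scalars, `x` divides `τ`, and `x` divides `σ` unless `σ = 1`. -/
structure Adapted (b : ℕ) : Prop where
  Y_eq : D.Y = S.y ^ b
  b_pos : 0 < b
  A_eq : ∃ β, β ≠ 0 ∧ D.A = S.c β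
  Γ_eq : ∃ β, β ≠ 0 ∧ D.Γ = S.c β
  Δ_eq : ∃ β, β ≠ 0 ∧ D.Δ = S.c β
  A_or_Γ : D.A = 1 ∨ D.Γ = 1
  σ_eq : D.σ = 1 ∨ S.x ∣ D.σ
  τ_eq : S.x ∣ D.τ
  q_pos : 1 ≤ D.q

/-- The elements of `R` that are scalars or divisible by `x`: those by which the `u k` may be
multiplied without leaving `relationGroup`. -/
def scalars : Submonoid R where
  carrier := {r | (∃ β, r = S.c β) ∨ S.x ∣ r}
  one_mem' := Or.inl ⟨1, by simp⟩
  mul_mem' := by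
    rintro _ _ (⟨β, rfl⟩ | h₁) (⟨β', rfl⟩ | h₂)
    · exact Or.inl ⟨β * β', by simp⟩
    · exact Or.inr (h₂.mul_left _)
    · exact Or.inr (h₁.mul_right _)
    · exact Or.inr (h₁.mul_right _)

variable {S} in
theorem neg_mem_scalars {r : R} (hr : r ∈ scalars S) : -r ∈ scalars S := by
  rcases hr with ⟨β, rfl⟩ | hx
  · exact Or.inl ⟨-β, by simp⟩
  · exact Or.inr (by simpa using hx)

variable {S} in
theorem scalars_mul_mem {u : ℕ → R} {L : ℕ} {J : Ideal R} (huJ : ∀ k ≤ L, u k ∈ J) {r : R}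
    (hr : r ∈ scalars S) {k : ℕ} (hk : k ≤ L) : r * u k ∈ S.relationGroup u L J := by
  rcases hr with ⟨β, rfl⟩ | hx
  · exact Slice.c_mul_mem_relationGroup β hk
  · exact Slice.x_mul_mem_relationGroup hx (huJ k hk)

namespace Adapted

variable {D S} {b : ℕ} (H : D.Adapted S b)
include H

theorem x_dvd_ξ : S.x ∣ D.ξ := H.τ_eq.mul_left _

theorem A_mem : D.A ∈ scalars S := let ⟨β, _, h⟩ := H.A_eq; Or.inl ⟨β, h⟩
theorem Γ_mem : D.Γ ∈ scalars S := let ⟨β, _, h⟩ := H.Γ_eq; Or.inl ⟨β, h⟩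
theorem Δ_mem : D.Δ ∈ scalars S := let ⟨β, _, h⟩ := H.Δ_eq; Or.inl ⟨β, h⟩
theorem σ_mem : D.σ ∈ scalars S := H.σ_eq.imp (fun h => ⟨1, by simp [h]⟩) id
theorem ζ_mem : D.ζ ∈ scalars S := mul_mem H.A_mem H.Δ_mem
theorem π_ξ : S.π D.ξ = 0 := by
  obtain ⟨w, hw⟩ := H.x_dvd_ξ
  rw [hw, map_mul, S.π_x, zero_mul]

theorem π_τ : S.π D.τ = 0 := by
  obtain ⟨w, hw⟩ := H.τ_eq
  rw [hw, map_mul, S.π_x, zero_mul]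

variable [IsDomain B]

theorem π_ζ : ∃ β, β ≠ 0 ∧ S.π D.ζ = C β := by
  obtain ⟨β, hβ, h⟩ := H.A_eq
  obtain ⟨β', hβ', h'⟩ := H.Δ_eq
  exact ⟨β * β', mul_ne_zero hβ hβ', by simp [ζ, h, h', S.π_c]⟩

theorem π_g : ∃ β, β ≠ 0 ∧ S.π D.g = C β := by
  obtain ⟨β, hβ, h⟩ := H.Γ_eq
  obtain ⟨β', hβ', h'⟩ := H.Δ_eq
  obtain ⟨β'', hβ'', h''⟩ := H.π_ζ
  exact ⟨β * β' * β'' ^ (D.q + 1), mul_ne_zero (mul_ne_zero hβ hβ') (pow_ne_zero _ hβ''),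
    by simp [g, h, h', h'', S.π_c, H.π_ξ]⟩

theorem degree_g : (S.π D.g).degree = (0 : ℕ) := by
  obtain ⟨β, hβ, h⟩ := H.π_g
  rw [h, degree_C hβ]; rfl

theorem degree_h : (S.π D.h).degree = (b : ℕ) := by
  obtain ⟨β, hβ, h⟩ := H.π_ζ
  have : S.π D.h = -(C β * X ^ b) := by
    simp [MatrixData.h, h, H.π_ξ, H.Y_eq, S.π_y, X_pow_mul_C]
  rw [this, degree_neg, degree_C_mul_X_pow _ hβ]

theorem π_T (j : ℕ) : ∃ β, β ≠ 0 ∧ S.π (D.T j) = C β := by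
  obtain ⟨β, hβ, h⟩ := H.π_ζ
  obtain ⟨β', hβ', h'⟩ := H.π_g
  induction j with
  | zero => exact ⟨1, one_ne_zero, by simp [T]⟩
  | succ j ih =>
    obtain ⟨β'', hβ'', h''⟩ := ih
    exact ⟨β * β' * β'', mul_ne_zero (mul_ne_zero hβ hβ') hβ'',
      by simp [T_succ, h, h', h'', H.π_ξ]⟩

theorem degree_d {j : ℕ} (hj : j ≤ D.q + 1) : (S.π (D.d j)).degree = (b * (j + 1) : ℕ) := by
  induction j with
  | zero => simp [d, H.Y_eq, S.π_y]
  | succ j ih =>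
    have hconst : ∃ β, S.π (D.Γ * D.Δ * D.σ * (D.ξ * D.ζ) ^ (D.q - j) * D.T j) = C β := by
      obtain ⟨β, -, h⟩ := H.Γ_eq
      obtain ⟨β', -, h'⟩ := H.Δ_eq
      obtain ⟨β'', -, h''⟩ := H.π_ζ
      obtain ⟨β₃, -, h₃⟩ := H.π_T j
      rcases H.σ_eq with hσ | ⟨w, hw⟩
      · exact ⟨β * β' * (0 * β'') ^ (D.q - j) * β₃,
          by simp [h, h', h'', h₃, hσ, H.π_ξ, S.π_c]⟩
      · exact ⟨0, by simp [hw, S.π_x]⟩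
    obtain ⟨β, hβ⟩ := hconst
    have hdeg : (S.π (-D.Y * D.d j)).degree = (b * (j + 1 + 1) : ℕ) := by
      rw [map_mul, map_neg, degree_mul, degree_neg, ih (by omega), H.Y_eq, map_pow, S.π_y,
        degree_X_pow]
      norm_cast
      ring
    rw [d_succ, map_sub, hβ, sub_eq_add_neg, ← C_neg, degree_add_C, hdeg]
    rw [hdeg]
    have := H.b_pos
    exact_mod_cast (by positivity : 0 < b * (j + 1 + 1))

theorem degree_f : (S.π D.f).degree = (b * 2 : ℕ) := by
  rw [← d_one]; exact H.degree_d (by omega)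

theorem degree_e : (S.π D.e).degree = (0 : ℕ) := by
  obtain ⟨β, hβ, h⟩ := H.Γ_eq
  obtain ⟨β', hβ', h'⟩ := H.π_T (D.q + 1)
  have : S.π D.e = C (-(β * β')) := by simp [e, H.π_τ, h, h', S.π_c]
  rw [this, degree_C (neg_ne_zero.2 (mul_ne_zero hβ hβ'))]; rfl

end Adapted

end MatrixData
end SpaceMonomialCurve

/-! ### Two ideals saturated by `x` -/

namespace SpaceMonomialCurve

open Polynomial

namespace MatrixData

variable {R : Type*} [CommRing R] (D : MatrixData R)

/-- The explicit form of the symbolic power of order `q + 2`; only the inclusion of the symbolic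
power in this ideal is needed. -/
def symbolicIdealOne : Ideal R :=
  Ideal.span {D.e} ⊔ D.I ^ (D.q + 2) ⊔ Ideal.span {D.d (D.q + 1)} * D.minors

/-- The explicit form, for `q ≥ 2`, of the symbolic power of order `q + 3`; again only the inclusion
of the symbolic power in this ideal is needed. -/
def symbolicIdealTwo : Ideal R :=
  Ideal.span {D.e} * D.I ⊔ D.I ^ (D.q + 3) ⊔ Ideal.span {D.d (D.q + 1)} * D.I ^ 2 ⊔
    Ideal.span {D.d 2 * D.d (D.q + 1)}

theorem f_mul_mem_symbolicIdealOne {v : R} (hv : v ∈ D.I ^ (D.q + 1)) :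
    D.f * v ∈ D.symbolicIdealOne := by
  rw [pow_succ] at hv
  have hle : (Ideal.span {D.d (D.q + 1)} ⊔ D.I ^ (D.q + 1)) * D.I ≤ D.symbolicIdealOne := by
    rw [Ideal.sup_mul, ← pow_succ]
    exact sup_le ((Ideal.mul_mono_right D.I_le_minors).trans le_sup_right)
      (le_sup_right.trans le_sup_left)
  refine Submodule.mul_induction_on hv (fun v hv z hz => ?_) fun v v' ih ih' => ?_
  · rw [← mul_assoc]
    exact hle (Ideal.mul_mem_mul (D.f_mul_mem hv) hz)
  · rw [mul_add]; exact add_mem ih ih'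

theorem f_mul_mem_symbolicIdealTwo {v : R} (hv : v ∈ D.I ^ (D.q + 2)) :
    D.f * v ∈ D.symbolicIdealTwo := by
  rw [pow_add] at hv
  have hle : (Ideal.span {D.d (D.q + 1)} ⊔ D.I ^ (D.q + 1)) * D.I ^ 2 ≤ D.symbolicIdealTwo := by
    rw [Ideal.sup_mul, ← pow_add]
    exact sup_le (le_sup_right.trans le_sup_left)
      (le_sup_right.trans (le_sup_left.trans le_sup_left))
  refine Submodule.mul_induction_on hv (fun v hv z hz => ?_) fun v v' ih ih' => ?_
  · rw [← mul_assoc]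
    exact hle (Ideal.mul_mem_mul (D.f_mul_mem hv) hz)
  · rw [mul_add]; exact add_mem ih ih'

theorem I_pow_le_symbolicIdealOne : D.I ^ (D.q + 2) ≤ D.symbolicIdealOne :=
  le_sup_right.trans le_sup_left

theorem I_pow_le_symbolicIdealTwo : D.I ^ (D.q + 3) ≤ D.symbolicIdealTwo :=
  le_sup_right.trans (le_sup_left.trans le_sup_left)

theorem d_mul_minors_le : Ideal.span {D.d (D.q + 1)} * D.minors ≤ D.symbolicIdealOne :=
  le_sup_right

theorem d_mul_I_sq_le : Ideal.span {D.d (D.q + 1)} * D.I ^ 2 ≤ D.symbolicIdealTwo :=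
  le_sup_right.trans le_sup_left

theorem e_mul_I_le : Ideal.span {D.e} * D.I ≤ D.symbolicIdealTwo :=
  le_sup_left.trans (le_sup_left.trans le_sup_left)

variable {B : Type*} [CommRing B] [IsDomain B] {S : Slice R B} {D}

/-- `symbolicIdealOne` is saturated by `x`, by the criterion for the generators `e`,
`g ^ (q + 2 - k) h ^ k` for `1 ≤ k ≤ q + 1`, `κ`, `d (q + 1) h`, `d (q + 1) f`. Here `κ` is one of
`h ^ (q + 2)` and `g d (q + 1)`, whichever generates the other one modulo `e`. -/
theorem Adapted.mem_symbolicIdealOne_of_x_mul_mem {b : ℕ} (H : D.Adapted S b) {w : R}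
    (hw : S.x * w ∈ D.symbolicIdealOne) : w ∈ D.symbolicIdealOne := by
  obtain ⟨κ, hκ⟩ : ∃ κ, (κ = D.h ^ (D.q + 2) ∧ D.A = 1) ∨
      (κ = D.g * D.d (D.q + 1) ∧ D.Γ = 1) := by
    rcases H.A_or_Γ with h | h
    exacts [⟨_, Or.inl ⟨rfl, h⟩⟩, ⟨_, Or.inr ⟨rfl, h⟩⟩]
  obtain ⟨u, hu⟩ : ∃ u : ℕ → R, u = fun k => if k = 0 then D.e else
    if k ≤ D.q + 1 then D.g ^ (D.q + 2 - k) * D.h ^ k else if k = D.q + 2 then κ else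
    if k = D.q + 3 then D.d (D.q + 1) * D.h else D.d (D.q + 1) * D.f := ⟨_, rfl⟩
  have u0 : u 0 = D.e := by simp [hu]
  have um : ∀ k, 1 ≤ k → k ≤ D.q + 1 → u k = D.g ^ (D.q + 2 - k) * D.h ^ k := by
    intro k h₁ h₂; simp [hu, show k ≠ 0 by omega, h₂]
  have uκ : u (D.q + 2) = κ := by simp [hu]
  have uh : u (D.q + 3) = D.d (D.q + 1) * D.h := by simp [hu]
  have uf : u (D.q + 4) = D.d (D.q + 1) * D.f := by simp [hu]
  clear hu
  have hcases : ∀ {p : ℕ → Prop}, p 0 → (∀ k, 1 ≤ k → k ≤ D.q + 1 → p k) → p (D.q + 2) →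
      p (D.q + 3) → p (D.q + 4) → ∀ k ≤ D.q + 4, p k := by
    intro p h0 hm h2 h3 h4 k hk
    rcases Nat.eq_zero_or_pos k with rfl | hpos
    · exact h0
    rcases Nat.lt_or_ge k (D.q + 2) with h | h
    · exact hm k hpos (by omega)
    obtain rfl | rfl | rfl : k = D.q + 2 ∨ k = D.q + 3 ∨ k = D.q + 4 := by omega
    exacts [h2, h3, h4]
  have hσe := D.σ_mul_e
  have heJ : D.e ∈ D.symbolicIdealOne :=
    Ideal.mem_sup_left (Ideal.mem_sup_left (Ideal.subset_span rfl))
  have hdJ : ∀ z ∈ D.minors, D.d (D.q + 1) * z ∈ D.symbolicIdealOne := fun z hz =>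
    D.d_mul_minors_le (Ideal.mul_mem_mul (Ideal.subset_span rfl) hz)
  have hgP : D.g ∈ D.minors := D.I_le_minors D.g_mem_I
  have hhP : D.h ∈ D.minors := D.I_le_minors D.h_mem_I
  have huJ : ∀ k ≤ D.q + 4, u k ∈ D.symbolicIdealOne := by
    refine hcases ?_ (fun k h₁ h₂ => ?_) ?_ ?_ ?_
    · rwa [u0]
    · rw [um k h₁ h₂]
      exact D.I_pow_le_symbolicIdealOne (D.g_pow_mul_h_pow_mem _ _ (by omega))
    · rw [uκ]
      rcases hκ with ⟨rfl, -⟩ | ⟨rfl, -⟩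
      · exact D.I_pow_le_symbolicIdealOne (Ideal.pow_mem_pow D.h_mem_I _)
      · rw [mul_comm]; exact hdJ _ hgP
    · rw [uh]; exact hdJ _ hhP
    · rw [uf]; exact hdJ _ D.f_mem_minors
  refine S.mem_of_x_mul_mem (u := u) (L := D.q + 4) (b := b) H.b_pos huJ ?_ ?_ ?_ hw
  · set K := Ideal.span {v | ∃ k ≤ D.q + 4, v = u k} with hK
    have huK : ∀ k ≤ D.q + 4, u k ∈ K := fun k hk => Ideal.subset_span ⟨k, hk, rfl⟩
    have he : D.e ∈ K := u0 ▸ huK 0 (by omega)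
    have hh : D.d (D.q + 1) * D.h ∈ K := uh ▸ huK _ (by omega)
    have hf : D.d (D.q + 1) * D.f ∈ K := uf ▸ huK _ (by omega)
    have hκK : κ ∈ K := uκ ▸ huK _ (by omega)
    have hhpow : D.h ^ (D.q + 2) ∈ K := by
      rcases hκ with ⟨rfl, -⟩ | ⟨rfl, hΓ⟩
      · exact hκK
      · have : D.h ^ (D.q + 2) = D.A * (D.g * D.d (D.q + 1)) - D.σ * D.e := by
          rw [hΓ] at hσe; linear_combination hσe
        rw [this]
        exact sub_mem (K.mul_mem_left _ hκK) (K.mul_mem_left _ he)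
    have hg : D.d (D.q + 1) * D.g ∈ K := by
      rcases hκ with ⟨rfl, hA⟩ | ⟨rfl, hΓ⟩
      · have : D.d (D.q + 1) * D.g = D.σ * D.e + D.Γ * D.h ^ (D.q + 2) := by
          rw [hA] at hσe; linear_combination -hσe
        rw [this]
        exact add_mem (K.mul_mem_left _ he) (K.mul_mem_left _ hκK)
      · rwa [mul_comm]
    refine sup_le (sup_le ?_ ?_) ?_
    · rw [Ideal.span_singleton_le_iff_mem]; exact he
    · refine span_pair_pow_le fun i j hij => ?_
      rcases Nat.eq_zero_or_pos j with rfl | hj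
      · have hi : i = D.q + 2 := by omega
        have : D.g ^ i * D.h ^ 0 = D.τ * (D.d (D.q + 1) * D.h) - D.Δ * D.e := by
          rw [hi]; linear_combination D.Δ_mul_e
        rw [this]
        exact sub_mem (K.mul_mem_left _ hh) (K.mul_mem_left _ he)
      rcases Nat.lt_or_ge j (D.q + 2) with h | h
      · have := huK j (by omega)
        rwa [um j hj (by omega), show D.q + 2 - j = i by omega] at this
      · obtain rfl : i = 0 := by omega
        obtain rfl : j = D.q + 2 := by omega
        simpa using hhpow
    · rw [minors, Ideal.span_mul_span', Ideal.span_le]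
      simp only [Set.singleton_mul, Set.image_subset_iff]
      rintro _ (rfl | rfl | rfl)
      exacts [hf, hg, hh]
  · have hd := H.degree_d (j := D.q + 1) le_rfl
    refine hcases ?_ (fun k h₁ h₂ => ?_) ?_ ?_ ?_
    · rw [u0, H.degree_e, mul_zero]
    · rw [um k h₁ h₂, map_mul, map_pow, map_pow, degree_mul, degree_pow, degree_pow,
        H.degree_g, H.degree_h]
      simp [mul_comm]
    · rw [uκ]
      rcases hκ with ⟨rfl, -⟩ | ⟨rfl, -⟩
      · rw [map_pow, degree_pow, H.degree_h]
        simp [mul_comm]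
      · rw [map_mul, degree_mul, H.degree_g, hd]
        norm_cast
        ring
    · rw [uh, map_mul, degree_mul, hd, H.degree_h]
      norm_cast
    · rw [uf, map_mul, degree_mul, hd, H.degree_f]
      norm_cast
      ring
  · intro k hk
    rw [← H.Y_eq]
    have hsc : ∀ {r : R}, r ∈ scalars S → ∀ {k}, k ≤ D.q + 4 →
        r * u k ∈ S.relationGroup u (D.q + 4) D.symbolicIdealOne := fun hr _ hk =>
      scalars_mul_mem huJ hr hk
    have hξJ : ∀ {r w : R}, S.x ∣ r → w ∈ D.symbolicIdealOne →
        r * w ∈ S.relationGroup u (D.q + 4) D.symbolicIdealOne := fun hr hw =>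
      Slice.x_mul_mem_relationGroup hr hw
    obtain ⟨z, hz, hghT⟩ := D.g_mul_h_mul_T H.q_pos
    have hzJ := D.I_pow_le_symbolicIdealOne hz
    have hg1 : u 1 = D.g ^ (D.q + 1) * D.h := by
      rw [um 1 le_rfl (by omega), pow_one]; rfl
    have hYg := D.Y_mul_g
    have hYh := D.Y_mul_h
    have hz₁ : D.Γ * D.Δ * D.ζ ^ D.q ∈ scalars S :=
      mul_mem (mul_mem H.Γ_mem H.Δ_mem) (pow_mem H.ζ_mem _)
    revert hk
    suffices ∀ k ≤ D.q + 4, k < D.q + 4 →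
      D.Y * u k ∈ S.relationGroup u (D.q + 4) D.symbolicIdealOne from fun hk => this k hk.le hk
    refine hcases (fun _ => ?_) (fun k h₁ h₂ _ => ?_) (fun _ => ?_) (fun _ => ?_)
      (fun h => absurd h (lt_irrefl _))
    · have : D.Y * u 0 = (-(D.A * D.τ)) * u (D.q + 4) + D.Γ * D.ζ ^ D.q * u 1
          + (D.Γ * D.ξ) * z := by
        rw [u0, uf, hg1]
        linear_combination D.Y_mul_e + D.Γ * hghT
      rw [this]
      exact add_mem (add_mem (Slice.mul_last_mem_relationGroup _)
        (hsc (mul_mem H.Γ_mem (pow_mem H.ζ_mem _)) (by omega)))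
        (hξJ (H.x_dvd_ξ.mul_left _) hzJ)
    · obtain ⟨i, hi⟩ : ∃ i, D.q + 1 = i + k := ⟨D.q + 1 - k, by omega⟩
      have hstep : D.Y * u k = D.ξ * -(D.f * (D.g ^ i * D.h ^ k))
          + -(D.Γ * D.Δ * D.ζ ^ D.q) * (D.g ^ i * D.h ^ (k + 1)) := by
        rw [um k h₁ h₂, show D.q + 2 - k = i + 1 by omega]
        linear_combination D.g ^ i * D.h ^ k * hYg
      rw [hstep]
      refine add_mem (hξJ H.x_dvd_ξ (neg_mem (D.f_mul_mem_symbolicIdealOne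
        (D.g_pow_mul_h_pow_mem _ _ hi.symm)))) ?_
      rcases Nat.lt_or_ge k (D.q + 1) with h | h
      · have := hsc (neg_mem_scalars hz₁) (k := k + 1) (by omega)
        rwa [um (k + 1) (by omega) (by omega), show D.q + 2 - (k + 1) = i by omega] at this
      · obtain rfl : k = D.q + 1 := by omega
        obtain rfl : i = 0 := by omega
        rw [pow_zero, one_mul]
        rcases hκ with ⟨hκ, hA⟩ | ⟨hκ, hΓ⟩
        · have := hsc (neg_mem_scalars hz₁) (k := D.q + 2) (by omega)
          rwa [uκ, hκ] at this
        · -- For `σ = 1` the term in `u 0` is not in `x J`; its coefficient is a scalar.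
          have : -(D.Γ * D.Δ * D.ζ ^ D.q) * (D.h ^ (D.q + 1 + 1))
              = -(D.Γ * D.Δ * D.ζ ^ D.q) * D.A * u (D.q + 2)
                + (D.Γ * D.Δ * D.ζ ^ D.q) * D.σ * u 0 := by
            rw [uκ, u0, hκ]
            rw [hΓ] at hσe ⊢
            linear_combination -(D.Δ * D.ζ ^ D.q) * hσe
          rw [this]
          exact add_mem (hsc (mul_mem (neg_mem_scalars hz₁) H.A_mem) (by omega))
            (hsc (mul_mem hz₁ H.σ_mem) (by omega))
    · rw [uκ]
      rcases hκ with ⟨hκ, hA⟩ | ⟨hκ, hΓ⟩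
      · have : D.Y * κ = -(D.ζ ^ (D.q + 1)) * u (D.q + 3) + -(D.σ * D.ζ ^ D.q) * u 1
            + (D.ξ * (-D.σ)) * z := by
          rw [uh, hg1, hκ]
          linear_combination D.h * D.Y_mul_h_pow - D.σ * hghT
        rw [this]
        exact add_mem (add_mem (hsc (neg_mem_scalars (pow_mem H.ζ_mem _)) (by omega))
          (hsc (neg_mem_scalars (mul_mem H.σ_mem (pow_mem H.ζ_mem _))) (by omega)))
          (hξJ (H.x_dvd_ξ.mul_right _) hzJ)
      · have : D.Y * κ = -D.ξ * u (D.q + 4) + -(D.Γ * D.Δ * D.ζ ^ D.q) * u (D.q + 3) := by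
          rw [uh, uf, hκ]
          linear_combination D.d (D.q + 1) * hYg
        rw [this]
        exact add_mem (Slice.mul_last_mem_relationGroup _)
          (hsc (neg_mem_scalars hz₁) (by omega))
    · have : D.Y * u (D.q + 3) = -D.ζ * u (D.q + 4)
          + (D.ξ ^ D.q * (-D.σ)) * (D.d (D.q + 1) * D.g) := by
        rw [uh, uf]
        linear_combination D.d (D.q + 1) * hYh
      rw [this]
      exact add_mem (Slice.mul_last_mem_relationGroup _)
        (hξJ ((dvd_pow H.x_dvd_ξ (by have := H.q_pos; omega)).mul_right _) (hdJ _ hgP))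

/-- `symbolicIdealTwo` is saturated by `x`, by the criterion for the generators `e g`, `e h`,
`g ^ (q + 3 - k) h ^ k` for `2 ≤ k ≤ q + 1`, `g κ`, `h κ`, `d (q + 1) h ^ 2`, `d 2 d (q + 1)`, with `κ`
as for `symbolicIdealOne`. -/
theorem Adapted.mem_symbolicIdealTwo_of_x_mul_mem {b : ℕ} (H : D.Adapted S b) (hq : 2 ≤ D.q)
    {w : R} (hw : S.x * w ∈ D.symbolicIdealTwo) : w ∈ D.symbolicIdealTwo := by
  obtain ⟨κ, hκ⟩ : ∃ κ, (κ = D.h ^ (D.q + 2) ∧ D.A = 1) ∨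
      (κ = D.g * D.d (D.q + 1) ∧ D.Γ = 1) := by
    rcases H.A_or_Γ with h | h
    exacts [⟨_, Or.inl ⟨rfl, h⟩⟩, ⟨_, Or.inr ⟨rfl, h⟩⟩]
  obtain ⟨u, hu⟩ : ∃ u : ℕ → R, u = fun k => if k = 0 then D.e * D.g else
    if k = 1 then D.e * D.h else
    if k ≤ D.q + 1 then D.g ^ (D.q + 3 - k) * D.h ^ k else if k = D.q + 2 then D.g * κ else
    if k = D.q + 3 then D.h * κ else
    if k = D.q + 4 then D.d (D.q + 1) * D.h ^ 2 else D.d 2 * D.d (D.q + 1) := ⟨_, rfl⟩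
  have u0 : u 0 = D.e * D.g := by simp [hu]
  have u1 : u 1 = D.e * D.h := by simp [hu]
  have um : ∀ k, 2 ≤ k → k ≤ D.q + 1 → u k = D.g ^ (D.q + 3 - k) * D.h ^ k := by
    intro k h₁ h₂; simp [hu, show k ≠ 0 by omega, show k ≠ 1 by omega, h₂]
  have ugκ : u (D.q + 2) = D.g * κ := by simp [hu]
  have uhκ : u (D.q + 3) = D.h * κ := by simp [hu]
  have uhh : u (D.q + 4) = D.d (D.q + 1) * D.h ^ 2 := by simp [hu]
  have ud : u (D.q + 5) = D.d 2 * D.d (D.q + 1) := by simp [hu]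
  clear hu
  have hcases : ∀ {p : ℕ → Prop}, p 0 → p 1 → (∀ k, 2 ≤ k → k ≤ D.q + 1 → p k) → p (D.q + 2) →
      p (D.q + 3) → p (D.q + 4) → p (D.q + 5) → ∀ k ≤ D.q + 5, p k := by
    intro p h0 h1 hm h2 h3 h4 h5 k hk
    rcases Nat.lt_or_ge k 2 with hpos | hpos
    · interval_cases k
      exacts [h0, h1]
    rcases Nat.lt_or_ge k (D.q + 2) with h | h
    · exact hm k hpos (by omega)
    obtain rfl | rfl | rfl | rfl : k = D.q + 2 ∨ k = D.q + 3 ∨ k = D.q + 4 ∨ k = D.q + 5 := by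
      omega
    exacts [h2, h3, h4, h5]
  have hσe := D.σ_mul_e
  have heJ : ∀ z ∈ D.I, D.e * z ∈ D.symbolicIdealTwo := fun z hz =>
    D.e_mul_I_le (Ideal.mul_mem_mul (Ideal.subset_span rfl) hz)
  have hdJ : ∀ z ∈ D.I ^ 2, D.d (D.q + 1) * z ∈ D.symbolicIdealTwo := fun z hz =>
    D.d_mul_I_sq_le (Ideal.mul_mem_mul (Ideal.subset_span rfl) hz)
  have hddJ : D.d 2 * D.d (D.q + 1) ∈ D.symbolicIdealTwo :=
    Ideal.mem_sup_right (Ideal.subset_span rfl)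
  have hgg : D.g ^ 2 ∈ D.I ^ 2 := Ideal.pow_mem_pow D.g_mem_I 2
  have hhh : D.h ^ 2 ∈ D.I ^ 2 := Ideal.pow_mem_pow D.h_mem_I 2
  have hgh : D.g * D.h ∈ D.I ^ 2 := by
    simpa using D.g_pow_mul_h_pow_mem 1 1 rfl
  have hfg : D.f * D.g = D.ξ * D.d 2 + D.Γ * D.Δ * D.ζ ^ (D.q - 1) * D.h ^ 2 := by
    have := D.d_mul_g (j := 1) H.q_pos
    rwa [d_one] at this
  have hfh : D.f * D.h = D.ζ * D.d 2 + D.σ * D.ξ ^ (D.q - 1) * D.g ^ 2 := by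
    have := D.d_mul_h (j := 1) H.q_pos
    rwa [d_one] at this
  have hdfJ : ∀ z ∈ D.I, D.d (D.q + 1) * D.f * z ∈ D.symbolicIdealTwo := by
    intro z hz
    obtain ⟨α, β, rfl⟩ := Ideal.mem_span_pair.1 hz
    have : D.d (D.q + 1) * D.f * (α * D.g + β * D.h)
        = (α * D.ξ + β * D.ζ) * (D.d 2 * D.d (D.q + 1))
          + (α * (D.Γ * D.Δ * D.ζ ^ (D.q - 1)) * (D.d (D.q + 1) * D.h ^ 2)
            + β * (D.σ * D.ξ ^ (D.q - 1)) * (D.d (D.q + 1) * D.g ^ 2)) := by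
      linear_combination α * D.d (D.q + 1) * hfg + β * D.d (D.q + 1) * hfh
    rw [this]
    exact add_mem (Ideal.mul_mem_left _ _ hddJ)
      (add_mem (Ideal.mul_mem_left _ _ (hdJ _ hhh)) (Ideal.mul_mem_left _ _ (hdJ _ hgg)))
  have huJ : ∀ k ≤ D.q + 5, u k ∈ D.symbolicIdealTwo := by
    refine hcases ?_ ?_ (fun k h₁ h₂ => ?_) ?_ ?_ ?_ ?_
    · rw [u0]; exact heJ _ D.g_mem_I
    · rw [u1]; exact heJ _ D.h_mem_I
    · rw [um k h₁ h₂]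
      exact D.I_pow_le_symbolicIdealTwo (D.g_pow_mul_h_pow_mem _ _ (by omega))
    · rw [ugκ]
      rcases hκ with ⟨rfl, -⟩ | ⟨rfl, -⟩
      · simpa using D.I_pow_le_symbolicIdealTwo (D.g_pow_mul_h_pow_mem 1 (D.q + 2) (by omega))
      · rw [show D.g * (D.g * D.d (D.q + 1)) = D.d (D.q + 1) * D.g ^ 2 by ring]
        exact hdJ _ hgg
    · rw [uhκ]
      rcases hκ with ⟨rfl, -⟩ | ⟨rfl, -⟩
      · rw [← pow_succ']
        exact D.I_pow_le_symbolicIdealTwo (Ideal.pow_mem_pow D.h_mem_I _)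
      · rw [show D.h * (D.g * D.d (D.q + 1)) = D.d (D.q + 1) * (D.g * D.h) by ring]
        exact hdJ _ hgh
    · rw [uhh]; exact hdJ _ hhh
    · rw [ud]; exact hddJ
  refine S.mem_of_x_mul_mem (u := u) (L := D.q + 5) (b := b) H.b_pos huJ ?_ ?_ ?_ hw
  · set K := Ideal.span {v | ∃ k ≤ D.q + 5, v = u k} with hK
    have huK : ∀ k ≤ D.q + 5, u k ∈ K := fun k hk => Ideal.subset_span ⟨k, hk, rfl⟩
    have heg : D.e * D.g ∈ K := u0 ▸ huK 0 (by omega)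
    have heh : D.e * D.h ∈ K := u1 ▸ huK 1 (by omega)
    have hgκ : D.g * κ ∈ K := ugκ ▸ huK _ (by omega)
    have hhκ : D.h * κ ∈ K := uhκ ▸ huK _ (by omega)
    have hdhh : D.d (D.q + 1) * D.h ^ 2 ∈ K := uhh ▸ huK _ (by omega)
    have hdd : D.d 2 * D.d (D.q + 1) ∈ K := ud ▸ huK _ (by omega)
    -- Modulo `e`, both `h ^ (q + 2)` and `d (q + 1) * g` are multiples of `κ`.
    have hpow : ∀ z, z * D.e ∈ K → z * κ ∈ K → z * D.h ^ (D.q + 2) ∈ K := by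
      intro z hze hzκ
      rcases hκ with ⟨rfl, -⟩ | ⟨rfl, hΓ⟩
      · exact hzκ
      · have : z * D.h ^ (D.q + 2)
            = D.A * (z * (D.g * D.d (D.q + 1))) - D.σ * (z * D.e) := by
          rw [hΓ] at hσe; linear_combination z * hσe
        rw [this]
        exact sub_mem (K.mul_mem_left _ hzκ) (K.mul_mem_left _ hze)
    have hdg : ∀ z, z * D.e ∈ K → z * κ ∈ K → z * (D.d (D.q + 1) * D.g) ∈ K := by
      intro z hze hzκ
      rcases hκ with ⟨rfl, hA⟩ | ⟨rfl, hΓ⟩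
      · have : z * (D.d (D.q + 1) * D.g) = D.σ * (z * D.e) + D.Γ * (z * D.h ^ (D.q + 2)) := by
          rw [hA] at hσe; linear_combination -z * hσe
        rw [this]
        exact add_mem (K.mul_mem_left _ hze) (K.mul_mem_left _ hzκ)
      · rwa [mul_comm (D.d _)]
    rw [mul_comm] at heg heh
    have hdgg := hdg _ heg hgκ
    have hdgh := hdg _ heh hhκ
    refine sup_le (sup_le (sup_le ?_ ?_) ?_) ?_
    · rw [I, Ideal.span_mul_span', Ideal.span_le]
      simp only [Set.singleton_mul, Set.image_subset_iff]
      rintro _ (rfl | rfl)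
      · simpa [mul_comm] using heg
      · simpa [mul_comm] using heh
    · refine span_pair_pow_le fun i j hij => ?_
      rcases Nat.lt_or_ge j 2 with hj | hj
      · have hpow' : ∀ z, D.g ^ (D.q + 2) * z
            = D.τ * (z * D.d (D.q + 1) * D.h) - D.Δ * (z * D.e) := by
          intro z; linear_combination z * D.Δ_mul_e
        interval_cases j
        · obtain rfl : i = D.q + 2 + 1 := by omega
          rw [pow_zero, mul_one, pow_succ, hpow']
          refine sub_mem (K.mul_mem_left _ ?_) (K.mul_mem_left _ heg)
          rwa [show D.g * D.d (D.q + 1) * D.h = D.h * (D.d (D.q + 1) * D.g) by ring]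
        · obtain rfl : i = D.q + 2 := by omega
          rw [pow_one, hpow']
          refine sub_mem (K.mul_mem_left _ ?_) (K.mul_mem_left _ heh)
          rwa [show D.h * D.d (D.q + 1) * D.h = D.d (D.q + 1) * D.h ^ 2 by ring]
      rcases Nat.lt_or_ge j (D.q + 2) with h | h
      · have := huK j (by omega)
        rwa [um j hj (by omega), show D.q + 3 - j = i by omega] at this
      · obtain rfl | rfl : j = D.q + 2 ∨ j = D.q + 2 + 1 := by omega
        · obtain rfl : i = 1 := by omega
          rw [pow_one]; exact hpow _ heg hgκ
        · obtain rfl : i = 0 := by omega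
          rw [pow_zero, one_mul, pow_succ']
          exact hpow _ heh hhκ
    · rw [Ideal.span_singleton_mul_le_iff]
      suffices D.I ^ 2 ≤ K.colon {D.d (D.q + 1)} by
        intro z hz
        simpa [Submodule.mem_colon_singleton, mul_comm] using this hz
      refine span_pair_pow_le fun i j hij => ?_
      rw [Submodule.mem_colon_singleton, smul_eq_mul]
      obtain ⟨rfl, rfl⟩ | ⟨rfl, rfl⟩ | ⟨rfl, rfl⟩ :
          (i = 2 ∧ j = 0) ∨ (i = 1 ∧ j = 1) ∨ (i = 0 ∧ j = 2) := by omega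
      · rwa [show D.g ^ 2 * D.h ^ 0 * D.d (D.q + 1) = D.g * (D.d (D.q + 1) * D.g) by ring]
      · rwa [show D.g ^ 1 * D.h ^ 1 * D.d (D.q + 1) = D.h * (D.d (D.q + 1) * D.g) by ring]
      · rwa [show D.g ^ 0 * D.h ^ 2 * D.d (D.q + 1) = D.d (D.q + 1) * D.h ^ 2 by ring]
    · rw [Ideal.span_singleton_le_iff_mem]; exact hdd
  · have hd := H.degree_d (j := D.q + 1) le_rfl
    have hd2 := H.degree_d (j := 2) (by omega)
    have hdκ : (S.π κ).degree = (b * (D.q + 2) : ℕ) := by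
      rcases hκ with ⟨rfl, -⟩ | ⟨rfl, -⟩
      · rw [map_pow, degree_pow, H.degree_h]
        simp [mul_comm]
      · rw [map_mul, degree_mul, H.degree_g, hd]
        norm_cast
        ring
    refine hcases ?_ ?_ (fun k h₁ h₂ => ?_) ?_ ?_ ?_ ?_
    · rw [u0, map_mul, degree_mul, H.degree_e, H.degree_g]
      simp
    · rw [u1, map_mul, degree_mul, H.degree_e, H.degree_h]
      simp
    · rw [um k h₁ h₂, map_mul, map_pow, map_pow, degree_mul, degree_pow, degree_pow,
        H.degree_g, H.degree_h]
      simp [mul_comm]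
    · rw [ugκ, map_mul, degree_mul, H.degree_g, hdκ]
      norm_cast
      ring
    · rw [uhκ, map_mul, degree_mul, H.degree_h, hdκ]
      norm_cast
      ring
    · rw [uhh, map_mul, map_pow, degree_mul, degree_pow, hd, H.degree_h, nsmul_eq_mul]
      norm_cast
      ring
    · rw [ud, map_mul, degree_mul, hd, hd2]
      norm_cast
      ring
  · intro k hk
    rw [← H.Y_eq]
    have hsc : ∀ {r : R}, r ∈ scalars S → ∀ {k}, k ≤ D.q + 5 →
        r * u k ∈ S.relationGroup u (D.q + 5) D.symbolicIdealTwo := fun hr _ hk =>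
      scalars_mul_mem huJ hr hk
    have hξJ : ∀ {r w : R}, S.x ∣ r → w ∈ D.symbolicIdealTwo →
        r * w ∈ S.relationGroup u (D.q + 5) D.symbolicIdealTwo := fun hr hw =>
      Slice.x_mul_mem_relationGroup hr hw
    obtain ⟨z, hz, hghT⟩ := D.g_mul_h_mul_T H.q_pos
    have hzg : D.g * z ∈ D.symbolicIdealTwo :=
      D.I_pow_le_symbolicIdealTwo (by rw [pow_succ']; exact Ideal.mul_mem_mul D.g_mem_I hz)
    have hzh : D.h * z ∈ D.symbolicIdealTwo :=
      D.I_pow_le_symbolicIdealTwo (by rw [pow_succ']; exact Ideal.mul_mem_mul D.h_mem_I hz)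
    have hg2 : u 2 = D.g ^ (D.q + 1) * D.h ^ 2 := by
      rw [um 2 le_rfl (by omega)]; rfl
    have hYg := D.Y_mul_g
    have hYh := D.Y_mul_h
    have hz₁ : D.Γ * D.Δ * D.ζ ^ D.q ∈ scalars S :=
      mul_mem (mul_mem H.Γ_mem H.Δ_mem) (pow_mem H.ζ_mem _)
    revert hk
    suffices ∀ k ≤ D.q + 5, k < D.q + 5 →
      D.Y * u k ∈ S.relationGroup u (D.q + 5) D.symbolicIdealTwo from fun hk => this k hk.le hk
    refine hcases (fun _ => ?_) (fun _ => ?_) (fun k h₁ h₂ _ => ?_) (fun _ => ?_) (fun _ => ?_)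
      (fun _ => ?_) (fun h => absurd h (lt_irrefl _))
    · have : D.Y * u 0 = D.τ * (-D.A * (D.d (D.q + 1) * D.f * D.g))
          + (D.τ * (D.Γ * D.ζ ^ D.q)) * (D.d (D.q + 1) * D.h ^ 2)
          + -(D.Γ * D.ζ ^ D.q * D.Δ) * u 1 + (D.ξ * D.Γ) * (D.g * z) := by
        rw [u0, u1]
        linear_combination D.g * D.Y_mul_e + D.Γ * D.g * hghT
          + D.Γ * D.ζ ^ D.q * D.h * D.Δ_mul_e
      rw [this]
      refine add_mem (add_mem (add_mem ?_ ?_) ?_) ?_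
      · exact hξJ H.τ_eq (Ideal.mul_mem_left _ _ (hdfJ _ D.g_mem_I))
      · exact hξJ (H.τ_eq.mul_right _) (hdJ _ hhh)
      · exact hsc (neg_mem_scalars (mul_mem (mul_mem H.Γ_mem (pow_mem H.ζ_mem _)) H.Δ_mem))
          (by omega)
      · exact hξJ (H.x_dvd_ξ.mul_right _) hzg
    · have : D.Y * u 1 = D.τ * (-D.A * (D.d (D.q + 1) * D.f * D.h))
          + (D.Γ * D.ζ ^ D.q) * u 2 + (D.ξ * D.Γ) * (D.h * z) := by
        rw [u1, hg2]
        linear_combination D.h * D.Y_mul_e + D.Γ * D.h * hghT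
      rw [this]
      refine add_mem (add_mem ?_ ?_) ?_
      · exact hξJ H.τ_eq (Ideal.mul_mem_left _ _ (hdfJ _ D.h_mem_I))
      · exact hsc (mul_mem H.Γ_mem (pow_mem H.ζ_mem _)) (by omega)
      · exact hξJ (H.x_dvd_ξ.mul_right _) hzh
    · obtain ⟨i, hi⟩ : ∃ i, D.q + 2 = i + k := ⟨D.q + 2 - k, by omega⟩
      have hstep : D.Y * u k = D.ξ * -(D.f * (D.g ^ i * D.h ^ k))
          + -(D.Γ * D.Δ * D.ζ ^ D.q) * (D.g ^ i * D.h ^ (k + 1)) := by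
        rw [um k h₁ h₂, show D.q + 3 - k = i + 1 by omega]
        linear_combination D.g ^ i * D.h ^ k * hYg
      rw [hstep]
      refine add_mem (hξJ H.x_dvd_ξ (neg_mem (D.f_mul_mem_symbolicIdealTwo
        (D.g_pow_mul_h_pow_mem _ _ hi.symm)))) ?_
      rcases Nat.lt_or_ge k (D.q + 1) with h | h
      · have := hsc (neg_mem_scalars hz₁) (k := k + 1) (by omega)
        rwa [um (k + 1) (by omega) (by omega), show D.q + 3 - (k + 1) = i by omega] at this
      · obtain rfl : k = D.q + 1 := by omega
        obtain rfl : i = 1 := by omega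
        rw [pow_one]
        rcases hκ with ⟨hκ, hA⟩ | ⟨hκ, hΓ⟩
        · have := hsc (neg_mem_scalars hz₁) (k := D.q + 2) (by omega)
          rwa [ugκ, hκ] at this
        · have : -(D.Γ * D.Δ * D.ζ ^ D.q) * (D.g * D.h ^ (D.q + 1 + 1))
              = -(D.Γ * D.Δ * D.ζ ^ D.q) * D.A * u (D.q + 2)
                + (D.Γ * D.Δ * D.ζ ^ D.q) * D.σ * u 0 := by
            rw [ugκ, u0, hκ]
            rw [hΓ] at hσe ⊢
            linear_combination -(D.Δ * D.ζ ^ D.q) * D.g * hσe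
          rw [this]
          exact add_mem (hsc (mul_mem (neg_mem_scalars hz₁) H.A_mem) (by omega))
            (hsc (mul_mem hz₁ H.σ_mem) (by omega))
    · rcases hκ with ⟨hκ, hA⟩ | ⟨hκ, hΓ⟩
      · have : D.Y * u (D.q + 2) = D.ξ * -(D.f * D.h ^ (D.q + 2))
            + -(D.Γ * D.Δ * D.ζ ^ D.q) * u (D.q + 3) := by
          rw [ugκ, uhκ, hκ]
          linear_combination D.h ^ (D.q + 2) * hYg
        rw [this]
        exact add_mem (hξJ H.x_dvd_ξ (neg_mem (D.f_mul_mem_symbolicIdealTwo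
          (Ideal.pow_mem_pow D.h_mem_I _)))) (hsc (neg_mem_scalars hz₁) (by omega))
      · have : D.Y * u (D.q + 2) = D.ξ * -(D.d (D.q + 1) * D.f * D.g)
            + -(D.Γ * D.Δ * D.ζ ^ D.q) * u (D.q + 3) := by
          rw [ugκ, uhκ, hκ]
          linear_combination D.d (D.q + 1) * D.g * hYg
        rw [this]
        exact add_mem (hξJ H.x_dvd_ξ (neg_mem (hdfJ _ D.g_mem_I)))
          (hsc (neg_mem_scalars hz₁) (by omega))
    · rcases hκ with ⟨hκ, hA⟩ | ⟨hκ, hΓ⟩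
      · have : D.Y * u (D.q + 3) = -(D.ζ ^ (D.q + 1)) * u (D.q + 4)
            + -(D.σ * D.ζ ^ D.q) * u 2 + (D.ξ * (-D.σ)) * (D.h * z) := by
          rw [uhκ, hg2, uhh, hκ]
          linear_combination D.h ^ 2 * D.Y_mul_h_pow - D.σ * D.h * hghT
        rw [this]
        exact add_mem (add_mem (hsc (neg_mem_scalars (pow_mem H.ζ_mem _)) (by omega))
          (hsc (neg_mem_scalars (mul_mem H.σ_mem (pow_mem H.ζ_mem _))) (by omega)))
          (hξJ (H.x_dvd_ξ.mul_right _) hzh)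
      · have : D.Y * u (D.q + 3) = D.ξ * -(D.d (D.q + 1) * D.f * D.h)
            + -(D.Γ * D.Δ * D.ζ ^ D.q) * u (D.q + 4) := by
          rw [uhκ, uhh, hκ]
          linear_combination D.d (D.q + 1) * D.h * hYg
        rw [this]
        exact add_mem (hξJ H.x_dvd_ξ (neg_mem (hdfJ _ D.h_mem_I)))
          (hsc (neg_mem_scalars hz₁) (by omega))
    · have : D.Y * u (D.q + 4) = -(D.ζ ^ 2) * u (D.q + 5)
          + (D.ξ ^ (D.q - 1) * (-(D.ζ * D.σ))) * (D.d (D.q + 1) * D.g ^ 2)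
          + (D.ξ ^ D.q * (-D.σ)) * (D.d (D.q + 1) * (D.g * D.h)) := by
        rw [uhh, ud]
        linear_combination D.d (D.q + 1) * D.h * hYh - D.ζ * D.d (D.q + 1) * hfh
      rw [this]
      exact add_mem (add_mem (Slice.mul_last_mem_relationGroup _)
        (hξJ ((dvd_pow H.x_dvd_ξ (by omega)).mul_right _) (hdJ _ hgg)))
        (hξJ ((dvd_pow H.x_dvd_ξ (by omega)).mul_right _) (hdJ _ hgh))

end MatrixData
end SpaceMonomialCurve

/-! ### Containment in ordinary powers -/

namespace SpaceMonomialCurve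

namespace MatrixData

variable {R : Type*} [CommRing R] (D : MatrixData R)

/-- The entries of the matrix, and the factor `τ` of `ξ`, lie in the ideal `𝔪`. -/
structure EntriesIn (𝔪 : Ideal R) : Prop where
  Y_mem : D.Y ∈ 𝔪
  ξ_mem : D.ξ ∈ 𝔪
  ζ_mem : D.ζ ∈ 𝔪
  τ_mem : D.τ ∈ 𝔪

namespace EntriesIn

variable {D} {𝔪 : Ideal R} (H : D.EntriesIn 𝔪)
include H

theorem minors_le (hq : 1 ≤ D.q) : D.minors ≤ 𝔪 := by
  rw [minors, Ideal.span_le]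
  rintro _ (rfl | rfl | rfl)
  · refine sub_mem (Ideal.pow_mem_of_mem _ H.Y_mem _ two_pos) (Ideal.mul_mem_right _ _ ?_)
    exact Ideal.mul_mem_left _ _ (Ideal.pow_mem_of_mem _ H.ξ_mem _ hq)
  · exact sub_mem (Ideal.mul_mem_left _ _ (Ideal.pow_mem_of_mem _ H.ζ_mem _ (by omega)))
      (Ideal.mul_mem_left _ _ H.Y_mem)
  · exact sub_mem (Ideal.mul_mem_left _ _ (Ideal.pow_mem_of_mem _ H.ξ_mem _ (by omega)))
      (Ideal.mul_mem_right _ _ H.Y_mem)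

theorem combination_mul_T_mem (j : ℕ) :
    (D.ζ * D.g + D.ξ * D.h) * D.T j ∈ 𝔪 * D.minors ^ (j + 1) := by
  have hT := Ideal.pow_right_mono D.I_le_minors j (D.T_mem j)
  rw [pow_succ', ← mul_assoc]
  refine Ideal.mul_mem_mul (add_mem ?_ ?_) hT
  · exact Ideal.mul_mem_mul H.ζ_mem (D.I_le_minors D.g_mem_I)
  · exact Ideal.mul_mem_mul H.ξ_mem (D.I_le_minors D.h_mem_I)

theorem d_even_mem {i : ℕ} (hi : 2 * i ≤ D.q + 1) : D.d (2 * i) ∈ 𝔪 * D.minors ^ i := by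
  induction i with
  | zero => simpa [d] using H.Y_mem
  | succ i ih =>
    rw [show 2 * (i + 1) = 2 * i + 2 by ring, D.d_add_two (by omega)]
    refine sub_mem ?_ ?_
    · rw [pow_succ', mul_left_comm]
      exact Ideal.mul_mem_mul D.f_mem_minors (ih (by omega))
    · rw [mul_assoc (_ * _)]
      refine Ideal.mul_mem_left _ _ (Ideal.mul_mono_right (Ideal.pow_le_pow_right ?_)
        (H.combination_mul_T_mem _))
      omega

theorem d_odd_mem {i : ℕ} (hi : 2 * i + 1 ≤ D.q + 1) : D.d (2 * i + 1) ∈ D.minors ^ (i + 1) := by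
  induction i with
  | zero => simpa [d_one] using D.f_mem_minors
  | succ i ih =>
    rw [show 2 * (i + 1) + 1 = 2 * i + 1 + 2 by ring, D.d_add_two (by omega)]
    refine sub_mem ?_ ?_
    · rw [pow_succ']
      exact Ideal.mul_mem_mul D.f_mem_minors (ih (by omega))
    · rw [mul_assoc (_ * _)]
      have h : (D.ζ * D.g + D.ξ * D.h) * D.T (2 * i + 1) ∈ D.minors ^ (2 * i + 1 + 1) :=
        Ideal.mul_le_right (H.combination_mul_T_mem _)
      exact Ideal.mul_mem_left _ _ (Ideal.pow_le_pow_right (by omega) h)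

theorem e_mem {t : ℕ} (ht : t ≤ D.q) (hd : D.d D.q ∈ D.minors ^ t) :
    D.e ∈ 𝔪 * D.minors ^ (t + 1) := by
  rw [e_eq]
  refine sub_mem ?_ ?_
  · rw [show D.A * D.τ * D.f * D.d D.q = D.A * (D.τ * (D.f * D.d D.q)) by ring]
    refine Ideal.mul_mem_left _ _ (Ideal.mul_mem_mul H.τ_mem ?_)
    rw [pow_succ']
    exact Ideal.mul_mem_mul D.f_mem_minors hd
  · rw [mul_assoc]
    refine Ideal.mul_mem_left _ _ (Ideal.mul_mono_right (Ideal.pow_le_pow_right ?_)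
      (H.combination_mul_T_mem _))
    omega

theorem I_pow_le (hq : 1 ≤ D.q) {s t : ℕ} (hst : t + 1 ≤ s) : D.I ^ s ≤ 𝔪 * D.minors ^ t := by
  obtain ⟨s, rfl⟩ : ∃ s', s = s' + 1 := ⟨s - 1, by omega⟩
  rw [pow_succ']
  exact Ideal.mul_mono (D.I_le_minors.trans (H.minors_le hq))
    ((Ideal.pow_right_mono D.I_le_minors s).trans (Ideal.pow_le_pow_right (by omega)))

theorem symbolicIdealOne_le (hq : 1 ≤ D.q) {i : ℕ} (hi : D.q + 1 = 2 * i) :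
    D.symbolicIdealOne ≤ 𝔪 * D.minors ^ (i + 1) := by
  refine sup_le (sup_le ?_ (H.I_pow_le hq (by omega))) ?_
  · rw [Ideal.span_singleton_le_iff_mem]
    refine H.e_mem (by omega) ?_
    have := H.d_odd_mem (i := i - 1) (by omega)
    rwa [show 2 * (i - 1) + 1 = D.q by omega, show i - 1 + 1 = i by omega] at this
  · rw [pow_succ, ← mul_assoc]
    refine Ideal.mul_mono_left ?_
    rw [Ideal.span_singleton_le_iff_mem, hi]
    exact H.d_even_mem hi.ge

theorem symbolicIdealTwo_le {i : ℕ} (hi : 1 ≤ i) (hq : D.q = 2 * i) :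
    D.symbolicIdealTwo ≤ 𝔪 * D.minors ^ (i + 2) := by
  have hd : D.d (D.q + 1) ∈ D.minors ^ (i + 1) := by
    rw [hq]; exact H.d_odd_mem (by omega)
  refine sup_le (sup_le (sup_le ?_ (H.I_pow_le (by omega) (by omega))) ?_) ?_
  · rw [pow_succ, ← mul_assoc]
    refine Ideal.mul_mono ?_ D.I_le_minors
    rw [Ideal.span_singleton_le_iff_mem]
    have hdq : D.d D.q ∈ 𝔪 * D.minors ^ i := by
      rw [hq]; exact H.d_even_mem (by omega)
    exact H.e_mem (by omega) (Ideal.mul_le_right hdq)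
  · rw [pow_two, pow_succ D.minors (i + 1), mul_comm 𝔪, mul_assoc]
    refine Ideal.mul_mono ?_ (Ideal.mul_mono D.I_le_minors
      (D.I_le_minors.trans (H.minors_le (by omega))))
    rwa [Ideal.span_singleton_le_iff_mem]
  · rw [Ideal.span_singleton_le_iff_mem, show i + 2 = 1 + (i + 1) by ring, pow_add, ← mul_assoc]
    exact Ideal.mul_mem_mul (H.d_even_mem (i := 1) (by omega)) hd

end EntriesIn
end MatrixData
end SpaceMonomialCurve

/-! ### Minors, and the slice of the polynomial ring -/

namespace SpaceMonomialCurve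
open MvPolynomial

section Minors

theorem minorsIdeal_eq_span {R : Type*} [CommRing R] (M : Matrix (Fin 2) (Fin 3) R) :
    minorsIdeal M = Ideal.span {M 0 1 * M 1 2 - M 0 2 * M 1 1, M 0 2 * M 1 0 - M 0 0 * M 1 2,
      M 0 0 * M 1 1 - M 0 1 * M 1 0} := by
  apply le_antisymm
  · rw [minorsIdeal, Ideal.span_le]
    rintro _ ⟨j, rfl⟩
    have hj : j 0 < j 1 := j.strictMono (by decide)
    simp only [Matrix.det_fin_two, Matrix.submatrix_apply, id, SetLike.mem_coe]
    generalize j 0 = s at hj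
    generalize j 1 = t at hj
    obtain ⟨rfl, rfl⟩ | ⟨rfl, rfl⟩ | ⟨rfl, rfl⟩ :
        (s = 0 ∧ t = 1) ∨ (s = 0 ∧ t = 2) ∨ (s = 1 ∧ t = 2) := by
      revert s t; decide
    · exact Ideal.subset_span (by simp)
    · rw [show M 0 0 * M 1 2 - M 0 2 * M 1 0 = -(M 0 2 * M 1 0 - M 0 0 * M 1 2) by ring]
      exact neg_mem (Ideal.subset_span (by simp))
    · exact Ideal.subset_span (by simp)
  · have hmem : ∀ s t : Fin 3, s < t → M 0 s * M 1 t - M 0 t * M 1 s ∈ minorsIdeal M := by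
      intro s t hst
      refine Ideal.subset_span ⟨OrderEmbedding.ofStrictMono ![s, t] ?_, ?_⟩
      · intro i j hij
        obtain ⟨rfl, rfl⟩ : i = 0 ∧ j = 1 := by revert i j; decide
        simpa using hst
      · rw [Matrix.det_fin_two]; rfl
    rw [Ideal.span_le]
    rintro _ (rfl | rfl | rfl)
    · exact hmem 1 2 (by decide)
    · rw [SetLike.mem_coe, show M 0 2 * M 1 0 - M 0 0 * M 1 2
        = -(M 0 0 * M 1 2 - M 0 2 * M 1 0) by ring]
      exact neg_mem (hmem 0 2 (by decide))
    · exact hmem 0 1 (by decide)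

end Minors

section PolynomialRing
variable (k : Type*) [Field k]

/-- The slice of `k[x, y, z]` by `x`, with quotient `k[z][y]`. -/
noncomputable def polynomialSlice : Slice (MvPolynomial (Fin 3) k) (Polynomial k) where
  x := X 0
  y := X 1
  c := (Polynomial.aeval (X 2 : MvPolynomial (Fin 3) k)).toRingHom
  π := (aeval ![0, Polynomial.X, Polynomial.C Polynomial.X] :
    MvPolynomial (Fin 3) k →ₐ[k] Polynomial (Polynomial k)).toRingHom
  π_c β := by
    simp only [AlgHom.toRingHom_eq_coe, RingHom.coe_coe]
    induction β using Polynomial.induction_on' with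
    | add p q hp hq => simp [hp, hq]
    | monomial n a =>
      rw [← Polynomial.C_mul_X_pow_eq_monomial]
      simp
  π_y := by simp
  π_x := by simp
  dvd_of_π_eq_zero w hw := by
    -- Modulo `x`, the identity agrees with restricting to `x = 0` and including `k[z][y]` back.
    have key : (Ideal.Quotient.mk (Ideal.span {(X 0 : MvPolynomial (Fin 3) k)})) =
        ((Ideal.Quotient.mk (Ideal.span {(X 0 : MvPolynomial (Fin 3) k)})).comp
          (Polynomial.eval₂RingHom (Polynomial.aeval (X 2 : MvPolynomial (Fin 3) k)).toRingHom
            (X 1))).comp (aeval ![0, Polynomial.X, Polynomial.C Polynomial.X] :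
              MvPolynomial (Fin 3) k →ₐ[k] Polynomial (Polynomial k)).toRingHom := by
      refine MvPolynomial.ringHom_ext (fun a => ?_) fun i => ?_
      · have : (algebraMap k (Polynomial (Polynomial k))) a
            = Polynomial.C (Polynomial.C a) := rfl
        simp [this]
      · fin_cases i
        · simp
        · simp
        · simp
    have h₁ := congrArg (fun φ => φ w) key
    simp only [RingHom.comp_apply, hw, map_zero] at h₁
    rwa [Ideal.Quotient.eq_zero_iff_mem, Ideal.mem_span_singleton] at h₁
  mul_left_cancel v w h := mul_left_cancel₀ (X_ne_zero 0) h

variable {k}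

/-- The minors `g` and `h` are relatively prime. -/
theorem isUnit_of_dvd_of_dvd {a b c p e : ℕ} (hb : 0 < b) (hp : 0 < p + a)
    {v : MvPolynomial (Fin 3) k} (hg : v ∣ X 2 ^ c - X 0 ^ a * X 1 ^ b)
    (hh : v ∣ X 0 ^ p - X 1 ^ b * X 2 ^ e) : IsUnit v := by
  -- Eliminating `y` gives a multiple of `v` that does not involve `y`.
  have hw : v ∣ X 0 ^ (p + a) + C (-1) * X 2 ^ (e + c) := by
    have := dvd_add (hg.mul_left (-(X 2 ^ e))) (hh.mul_left (X 0 ^ a))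
    convert this using 1
    rw [C_neg, C_1]; ring
  have hw0 : (X 0 ^ (p + a) + C (-1) * X 2 ^ (e + c) : MvPolynomial (Fin 3) k) ≠ 0 := by
    intro h0
    have := congrArg (aeval ![(0 : k), 0, 1]) h0
    simp [zero_pow hp.ne'] at this
  have hdeg : degreeOf 1 v = 0 := by
    obtain ⟨v', hv'⟩ := hw
    have h₁ : degreeOf 1 (X 0 ^ (p + a) + C (-1) * X 2 ^ (e + c) : MvPolynomial (Fin 3) k) = 0 := by
      refine Nat.le_zero.1 ((degreeOf_add_le _ _ _).trans (max_le ?_ ?_))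
      · rw [degreeOf_X_pow_of_ne _ (by decide)]
      · refine (degreeOf_C_mul_le _ _ _).trans ?_
        rw [degreeOf_X_pow_of_ne _ (by decide)]
    rw [hv'] at h₁ hw0
    rw [degreeOf_mul_eq (left_ne_zero_of_mul hw0) (right_ne_zero_of_mul hw0)] at h₁
    omega
  have hfix : ∀ t : MvPolynomial (Fin 3) k, aeval ![X 0, t, X 2] v = v := by
    intro t
    have : (aeval ![X 0, t, X 2] : MvPolynomial (Fin 3) k →ₐ[k] _).toRingHom v
        = RingHom.id (MvPolynomial (Fin 3) k) v := by
      refine hom_congr_vars (by ext; simp) (fun i hi _ => ?_) rfl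
      fin_cases i
      · simp
      · exfalso
        obtain ⟨m, hm, hm1⟩ := (mem_vars_iff_mem_support _).1 hi
        have := monomial_le_degreeOf 1 hm
        rw [hdeg] at this
        simp at hm1
        omega
      · simp
    exact this
  have h0 : v ∣ X 2 ^ c := by
    have := map_dvd (aeval ![X 0, 0, X 2] : MvPolynomial (Fin 3) k →ₐ[k] MvPolynomial (Fin 3) k) hg
    rw [hfix] at this
    simpa [hb.ne'] using this
  have h1 : v ∣ X 0 ^ a := by
    have := map_dvd (aeval ![X 0, 1, X 2] : MvPolynomial (Fin 3) k →ₐ[k] MvPolynomial (Fin 3) k) hg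
    rw [hfix] at this
    have := dvd_sub h0 this
    simpa using this
  obtain ⟨m, u, hm, hu, rfl⟩ := dvd_monomial_one_iff_exists.1 (X_pow_eq_monomial (R := k) ▸ h0)
  obtain ⟨m', u', hm', -, he⟩ := dvd_monomial_one_iff_exists.1 (X_pow_eq_monomial (R := k) ▸ h1)
  have hmm : m = 0 := by
    have h3 : m = m' := by
      rcases (monomial_eq_monomial_iff _ _ _ _).1 he with h | h
      · exact h.1
      · exact absurd h.1 hu.ne_zero
    ext i
    have hi := hm i
    have hi' := hm' i
    rw [← h3] at hi'
    fin_cases i <;> simp_all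
  rw [hmm]
  exact hu.map C

end PolynomialRing
end SpaceMonomialCurve

/-! ### Curves of type `1'` -/

namespace SpaceMonomialCurve
open MvPolynomial

section Curve
variable (k : Type*) [Field k]

/-- The data of a curve of type `1'`. The subtraction `c₁ - a₂ / a₁ * c₂` is exact there
(`IsTypeOnePrime.mul_le`); of `A` and `Γ`, the one whose exponent would be negative is `1` by
truncation. -/
noncomputable def curveData (a₁ a₂ b c₁ c₂ : ℕ) : MatrixData (MvPolynomial (Fin 3) k) where
  Y := X 1 ^ b
  σ := X 0 ^ (a₂ % a₁)
  τ := X 0 ^ (a₁ - a₂ % a₁)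
  A := X 2 ^ (c₂ - (c₁ - a₂ / a₁ * c₂))
  Δ := X 2 ^ min c₂ (c₁ - a₂ / a₁ * c₂)
  Γ := X 2 ^ (c₁ - a₂ / a₁ * c₂ - c₂)
  q := a₂ / a₁

variable {k} {a₁ a₂ b₁ b₂ c₁ c₂ : ℕ}

theorem curveData_ζ : (curveData k a₁ a₂ b₁ c₁ c₂).ζ = X 2 ^ c₂ := by
  simp only [MatrixData.ζ, curveData, ← pow_add]
  congr 1; omega

theorem IsTypeOnePrime.mul_le (hM : IsTypeOnePrime a₁ a₂ b₁ b₂ c₁ c₂) :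
    a₂ / a₁ * c₂ ≤ c₁ := by
  have ha : (0 : ℚ) < a₁ := by exact_mod_cast hM.a₁_pos
  have hc : (0 : ℚ) < c₂ := by exact_mod_cast hM.c₂_pos
  have h₁ := (div_le_div_iff₀ ha hc).1 hM.ratio_le
  have h₂ : a₂ * c₂ ≤ c₁ * a₁ := by exact_mod_cast h₁
  refine Nat.le_of_mul_le_mul_right ?_ hM.a₁_pos
  calc a₂ / a₁ * c₂ * a₁ = a₂ / a₁ * a₁ * c₂ := by ring
    _ ≤ a₂ * c₂ := Nat.mul_le_mul_right _ (Nat.div_mul_le_self _ _)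
    _ ≤ c₁ * a₁ := h₂

variable (hM : IsTypeOnePrime a₁ a₂ b₁ b₂ c₁ c₂)
include hM

theorem IsTypeOnePrime.curveData_ξ : (curveData k a₁ a₂ b₁ c₁ c₂).ξ = X 0 ^ a₁ := by
  have := Nat.mod_lt a₂ hM.a₁_pos
  simp only [MatrixData.ξ, curveData, ← pow_add]
  congr 1; omega

theorem IsTypeOnePrime.curveData_σ_mul :
    (curveData k a₁ a₂ b₁ c₁ c₂).σ * (curveData k a₁ a₂ b₁ c₁ c₂).ξ ^ (a₂ / a₁) = X 0 ^ a₂ := by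
  rw [hM.curveData_ξ, ← pow_mul]
  simp only [curveData, ← pow_add]
  rw [Nat.mod_add_div]

theorem IsTypeOnePrime.curveData_ΓΔ_mul :
    (curveData k a₁ a₂ b₁ c₁ c₂).Γ * (curveData k a₁ a₂ b₁ c₁ c₂).Δ
      * (curveData k a₁ a₂ b₁ c₁ c₂).ζ ^ (a₂ / a₁) = X 2 ^ c₁ := by
  rw [curveData_ζ, ← pow_mul]
  simp only [curveData, ← pow_add]
  congr 1
  have := hM.mul_le
  rw [mul_comm c₂]
  omega

theorem IsTypeOnePrime.q_pos : 1 ≤ a₂ / a₁ := (Nat.one_le_div_iff hM.a₁_pos).2 hM.a_le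

theorem IsTypeOnePrime.curveData_f : (curveData k a₁ a₂ b₁ c₁ c₂).f
    = X 1 ^ b₁ * X 1 ^ b₂ - X 2 ^ c₁ * X 0 ^ a₂ := by
  rw [MatrixData.f, ← hM.b_eq, ← hM.curveData_σ_mul (k := k), ← hM.curveData_ΓΔ_mul (k := k)]
  simp only [curveData]
  ring

theorem IsTypeOnePrime.curveData_g : (curveData k a₁ a₂ b₁ c₁ c₂).g
    = X 2 ^ c₁ * X 2 ^ c₂ - X 0 ^ a₁ * X 1 ^ b₁ := by
  rw [MatrixData.g, hM.curveData_ξ, ← hM.curveData_ΓΔ_mul (k := k),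
    ← curveData_ζ (k := k) (b₁ := b₁)]
  simp only [curveData]
  ring

theorem IsTypeOnePrime.curveData_h : (curveData k a₁ a₂ b₁ c₁ c₂).h
    = X 0 ^ a₁ * X 0 ^ a₂ - X 1 ^ b₁ * X 2 ^ c₂ := by
  rw [MatrixData.h, curveData_ζ, ← hM.curveData_σ_mul (k := k),
    ← hM.curveData_ξ (k := k) (b₁ := b₁)]
  simp only [curveData]
  ring

theorem IsTypeOnePrime.curveIdeal_eq :
    curveIdeal k a₁ a₂ b₁ b₂ c₁ c₂ = (curveData k a₁ a₂ b₁ c₁ c₂).minors := by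
  rw [curveIdeal, minorsIdeal_eq_span, MatrixData.minors, hM.curveData_f, hM.curveData_g,
    hM.curveData_h]
  simp [curveMatrix, hM.b_eq]

theorem IsTypeOnePrime.adapted :
    (curveData k a₁ a₂ b₁ c₁ c₂).Adapted (polynomialSlice k) b₁ where
  Y_eq := rfl
  b_pos := hM.b₁_pos
  A_eq := ⟨Polynomial.X ^ (c₂ - (c₁ - a₂ / a₁ * c₂)), by simp,
    by simp [curveData, polynomialSlice]⟩
  Γ_eq := ⟨Polynomial.X ^ (c₁ - a₂ / a₁ * c₂ - c₂), by simp,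
    by simp [curveData, polynomialSlice]⟩
  Δ_eq := ⟨Polynomial.X ^ min c₂ (c₁ - a₂ / a₁ * c₂), by simp,
    by simp [curveData, polynomialSlice]⟩
  A_or_Γ := by
    rcases le_total c₂ (c₁ - a₂ / a₁ * c₂) with h | h
    · exact Or.inl (by simp [curveData, Nat.sub_eq_zero_of_le h])
    · exact Or.inr (by simp [curveData, Nat.sub_eq_zero_of_le h])
  σ_eq := by
    rcases Nat.eq_zero_or_pos (a₂ % a₁) with h | h
    · exact Or.inl (by simp [curveData, h])
    · exact Or.inr (dvd_pow_self _ h.ne')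
  τ_eq := dvd_pow_self _ (Nat.sub_pos_of_lt (Nat.mod_lt _ hM.a₁_pos)).ne'
  q_pos := hM.q_pos

theorem IsTypeOnePrime.entriesIn :
    (curveData k a₁ a₂ b₁ c₁ c₂).EntriesIn (irrelevantIdeal k) where
  Y_mem := Ideal.pow_mem_of_mem _ (Ideal.subset_span (by simp)) _ hM.b₁_pos
  ξ_mem := by
    rw [hM.curveData_ξ]
    exact Ideal.pow_mem_of_mem _ (Ideal.subset_span (by simp)) _ hM.a₁_pos
  ζ_mem := by
    rw [curveData_ζ]
    exact Ideal.pow_mem_of_mem _ (Ideal.subset_span (by simp)) _ hM.c₂_pos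
  τ_mem := Ideal.pow_mem_of_mem _ (Ideal.subset_span (by simp)) _
    (Nat.sub_pos_of_lt (Nat.mod_lt _ hM.a₁_pos))

theorem IsTypeOnePrime.dvd_of_dvd_mul (α : MvPolynomial (Fin 3) k)
    (h : (curveData k a₁ a₂ b₁ c₁ c₂).g ∣ α * (curveData k a₁ a₂ b₁ c₁ c₂).h) :
    (curveData k a₁ a₂ b₁ c₁ c₂).g ∣ α := by
  refine IsRelPrime.dvd_of_dvd_mul_right (fun v hg hh => ?_) h
  rw [hM.curveData_g, ← pow_add] at hg
  rw [hM.curveData_h, ← pow_add] at hh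
  exact isUnit_of_dvd_of_dvd hM.b₁_pos (by have := hM.a₁_pos; omega) hg hh

theorem IsTypeOnePrime.X_notMem_minors :
    (X 0 : MvPolynomial (Fin 3) k) ∉ (curveData k a₁ a₂ b₁ c₁ c₂).minors := by
  set D := curveData k a₁ a₂ b₁ c₁ c₂ with hD
  -- The tangent vector in the direction of `x` at the origin kills every minor, but not `x`.
  let φ : MvPolynomial (Fin 3) k →ₐ[k] DualNumber k := aeval ![DualNumber.eps, 0, 0]
  have hY : φ D.Y = 0 := by simp [φ, hD, curveData, zero_pow hM.b₁_pos.ne']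
  have hζ : φ D.ζ = 0 := by
    rw [curveData_ζ]; simp [φ, zero_pow hM.c₂_pos.ne']
  have hξ : φ D.ξ ^ 2 = 0 := by
    rw [hM.curveData_ξ]
    simp only [φ, map_pow, aeval_X, Matrix.cons_val_zero]
    rw [← pow_mul, mul_comm, pow_mul, pow_two, DualNumber.eps_mul_eps, zero_pow hM.a₁_pos.ne']
  have hq : D.q ≠ 0 := (Nat.pos_of_ne_zero (Nat.one_le_iff_ne_zero.1 hM.q_pos)).ne'
  have hker : D.minors ≤ RingHom.ker φ.toRingHom := by
    rw [MatrixData.minors, Ideal.span_le]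
    rintro _ (rfl | rfl | rfl) <;>
      simp only [SetLike.mem_coe, RingHom.mem_ker, AlgHom.toRingHom_eq_coe, RingHom.coe_coe]
    · simp [MatrixData.f, hY, hζ, hq]
    · simp [MatrixData.g, hY, hζ]
    · simp only [MatrixData.h, map_sub, map_mul, map_pow, hY, zero_mul, sub_zero]
      rw [show D.q + 1 = 2 + (D.q - 1) by omega, pow_add, hξ]
      simp
  intro hx
  have h0 : φ (X 0) = 0 := hker hx
  have h1 : (DualNumber.eps : DualNumber k) = 0 := by simpa [φ] using h0
  simpa using congrArg TrivSqZeroExt.snd h1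

theorem IsTypeOnePrime.d_notMem {i : ℕ} (hi : 2 * i + 1 ≤ a₂ / a₁ + 1) :
    (curveData k a₁ a₂ b₁ c₁ c₂).d (2 * i + 1) ∉
      irrelevantIdeal k * (curveData k a₁ a₂ b₁ c₁ c₂).minors ^ (i + 1) := by
  set D := curveData k a₁ a₂ b₁ c₁ c₂ with hD
  -- On the `y`-axis `d (2 i + 1)` has order `b₁ (2 i + 2)`, the order of `f ^ (i + 1)`.
  let ψ : MvPolynomial (Fin 3) k →ₐ[k] Polynomial k := aeval ![0, Polynomial.X, 0]
  have hY : ψ D.Y = Polynomial.X ^ b₁ := by simp [ψ, hD, curveData]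
  have hζ : ψ D.ζ = 0 := by
    rw [curveData_ζ]; simp [ψ, zero_pow hM.c₂_pos.ne']
  have hξ : ψ D.ξ = 0 := by
    rw [hM.curveData_ξ]; simp [ψ, zero_pow hM.a₁_pos.ne']
  have hq : 1 ≤ D.q := hM.q_pos
  have hd : ∀ j ≤ D.q + 1, ψ (D.d j) = (-1) ^ (j + 1) * Polynomial.X ^ (b₁ * (j + 1)) := by
    intro j
    induction j with
    | zero => intro _; simp [MatrixData.d, hY]
    | succ j ih =>
      intro hj
      have hz : ψ ((D.ξ * D.ζ) ^ (D.q - j) * D.T j) = 0 := by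
        rcases Nat.eq_zero_or_pos j with rfl | hpos
        · rw [map_mul, map_pow, map_mul, hξ, zero_mul, zero_pow (by omega), zero_mul]
        · obtain ⟨j, rfl⟩ : ∃ j', j = j' + 1 := ⟨j - 1, by omega⟩
          rw [D.T_succ]
          simp [hξ, hζ]
      rw [D.d_succ, mul_assoc, map_sub, map_mul _ (_ * _), hz, map_mul, map_neg, hY,
        ih (by omega)]
      ring
  have hP : D.minors.map ψ.toRingHom ≤ Ideal.span {Polynomial.X ^ (b₁ * 2)} := by
    rw [Ideal.map_le_iff_le_comap, MatrixData.minors, Ideal.span_le]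
    rintro _ (rfl | rfl | rfl) <;>
      simp only [SetLike.mem_coe, Ideal.mem_comap, AlgHom.toRingHom_eq_coe, RingHom.coe_coe,
        Ideal.mem_span_singleton]
    · rw [← D.d_one, hd 1 (by omega)]
      simp
    · simp [MatrixData.g, hξ, hζ]
    · simp [MatrixData.h, hξ, hζ]
  have h𝔪 : (irrelevantIdeal k).map ψ.toRingHom ≤ Ideal.span {Polynomial.X} := by
    rw [Ideal.map_le_iff_le_comap, irrelevantIdeal, Ideal.span_le]
    rintro _ (rfl | rfl | rfl) <;>
      simp [ψ]
  intro hmem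
  have hmem' := Ideal.mem_map_of_mem ψ.toRingHom hmem
  rw [Ideal.map_mul, Ideal.map_pow] at hmem'
  have hmem'' := Ideal.mul_mono h𝔪 (Ideal.pow_right_mono hP (i + 1)) hmem'
  rw [Ideal.span_singleton_pow, Ideal.span_singleton_mul_span_singleton,
    Ideal.mem_span_singleton] at hmem''
  have hdvd : (Polynomial.X : Polynomial k) ^ (b₁ * 2 * (i + 1) + 1)
      ∣ Polynomial.X ^ (b₁ * 2 * (i + 1)) := by
    have h₁ : ψ.toRingHom (D.d (2 * i + 1)) = Polynomial.X ^ (b₁ * 2 * (i + 1)) := by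
      have := hd (2 * i + 1) hi
      rw [show 2 * i + 1 + 1 = 2 * (i + 1) by ring, pow_mul (-1 : Polynomial k), neg_one_sq,
        one_pow, one_mul, ← mul_assoc] at this
      exact this
    rw [h₁] at hmem''
    rwa [← pow_mul, ← pow_succ'] at hmem''
  have := (pow_dvd_pow_iff Polynomial.X_ne_zero Polynomial.not_isUnit_X).1 hdvd
  omega

theorem IsTypeOnePrime.d_mem_symbolicPower [(curveData k a₁ a₂ b₁ c₁ c₂).minors.IsPrime] {j : ℕ}
    (hj : j ≤ a₂ / a₁ + 1) :
    (curveData k a₁ a₂ b₁ c₁ c₂).d j ∈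
      symbolicPower (curveData k a₁ a₂ b₁ c₁ c₂).minors j := by
  set D := curveData k a₁ a₂ b₁ c₁ c₂ with hD
  refine mem_symbolicPower_iff.2 ⟨D.ξ ^ (j + 1), fun h => ?_, ?_⟩
  · rw [hM.curveData_ξ, ← pow_mul] at h
    exact hM.X_notMem_minors (Ideal.IsPrime.mem_of_pow_mem ‹_› _ h)
  · rw [D.ξ_pow_mul_d hj]
    refine sub_mem ?_ ?_
    · exact Ideal.pow_le_pow_right (by omega)
        (Ideal.pow_mem_pow (D.I_le_minors D.g_mem_I) (j + 1))
    · exact Ideal.mul_mem_left _ _ (Ideal.pow_right_mono D.I_le_minors j (D.T_mem j))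

theorem IsTypeOnePrime.symbolicPower_le [(curveData k a₁ a₂ b₁ c₁ c₂).minors.IsPrime] {n : ℕ}
    {J : Ideal (MvPolynomial (Fin 3) k)} (hJ : (curveData k a₁ a₂ b₁ c₁ c₂).I ^ n ≤ J)
    (hx : ∀ w, X 0 * w ∈ J → w ∈ J) :
    symbolicPower (curveData k a₁ a₂ b₁ c₁ c₂).minors n ≤ J := by
  set D := curveData k a₁ a₂ b₁ c₁ c₂ with hD
  refine symbolicPower_le_of_span_pair_pow_le (a := a₁) (x := X 0) ?_ hM.dvd_of_dvd_mul
    (D.I_le_minors D.g_mem_I) (D.I_le_minors D.h_mem_I) (fun α hα => ?_)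
    hM.X_notMem_minors hJ hx
  · intro h0
    obtain ⟨β, hβ, h⟩ := (hM.adapted (k := k)).π_g
    rw [← hD, h0, map_zero] at h
    exact hβ (Polynomial.C_eq_zero.1 h.symm)
  · rw [← hM.curveData_ξ (k := k) (b₁ := b₁)]
    exact D.ξ_mul_mem_I hα

theorem IsTypeOnePrime.not_symbolicPower_le [(curveData k a₁ a₂ b₁ c₁ c₂).minors.IsPrime] {l : ℕ}
    (hl : 1 ≤ l) (hln : l ≤ nIndex a₁ a₂ - 1) :
    ¬ symbolicPower (curveData k a₁ a₂ b₁ c₁ c₂).minors (2 * l - 1)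
      ≤ irrelevantIdeal k * (curveData k a₁ a₂ b₁ c₁ c₂).minors ^ l := by
  intro hle
  obtain ⟨i, rfl⟩ : ∃ i, l = i + 1 := ⟨l - 1, by omega⟩
  simp only [nIndex, rIndex] at hln
  rw [show 2 * (i + 1) - 1 = 2 * i + 1 by omega] at hle
  exact hM.d_notMem (by omega) (hle (hM.d_mem_symbolicPower (by omega)))

theorem IsTypeOnePrime.symbolicPower_nIndex_le
    [(curveData k a₁ a₂ b₁ c₁ c₂).minors.IsPrime] :
    symbolicPower (curveData k a₁ a₂ b₁ c₁ c₂).minors (2 * nIndex a₁ a₂ - 1)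
      ≤ irrelevantIdeal k * (curveData k a₁ a₂ b₁ c₁ c₂).minors ^ nIndex a₁ a₂ := by
  have hq := hM.q_pos
  have hE := hM.entriesIn (k := k)
  have hA := hM.adapted (k := k)
  have hqD : (curveData k a₁ a₂ b₁ c₁ c₂).q = a₂ / a₁ := rfl
  rcases Nat.even_or_odd' (a₂ / a₁ + 1) with ⟨i, hi | hi⟩
  · have hn : nIndex a₁ a₂ = i + 1 := by simp only [nIndex, rIndex]; omega
    rw [hn]
    refine (hM.symbolicPower_le ?_ fun w => hA.mem_symbolicIdealOne_of_x_mul_mem).trans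
      (hE.symbolicIdealOne_le hq hi)
    rw [show 2 * (i + 1) - 1 = a₂ / a₁ + 2 by omega, ← hqD]
    exact MatrixData.I_pow_le_symbolicIdealOne _
  · have hn : nIndex a₁ a₂ = i + 2 := by simp only [nIndex, rIndex]; omega
    rw [hn]
    refine (hM.symbolicPower_le ?_ fun w => hA.mem_symbolicIdealTwo_of_x_mul_mem
      (by rw [hqD]; omega)).trans (hE.symbolicIdealTwo_le (i := i) (by omega) (by rw [hqD]; omega))
    rw [show 2 * (i + 2) - 1 = a₂ / a₁ + 3 by omega, ← hqD]
    exact MatrixData.I_pow_le_symbolicIdealTwo _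

end Curve
end SpaceMonomialCurve

theorem theorem1p6 {k : Type*} [Field k] (a₁ a₂ b₁ b₂ c₁ c₂ : ℕ)
    (hM : SpaceMonomialCurve.IsTypeOnePrime a₁ a₂ b₁ b₂ c₁ c₂)
    (P : Ideal (MvPolynomial (Fin 3) k)) [P.IsPrime]
    (hP : P = SpaceMonomialCurve.curveIdeal k a₁ a₂ b₁ b₂ c₁ c₂)
    (n : ℕ) (hn : n = SpaceMonomialCurve.nIndex a₁ a₂) :
    (∀ l : ℕ, 1 ≤ l → l ≤ n - 1 →
      ¬ SpaceMonomialCurve.symbolicPower P (2 * l - 1)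
          ≤ SpaceMonomialCurve.irrelevantIdeal k * P ^ l) ∧
    SpaceMonomialCurve.symbolicPower P (2 * n - 1)
        ≤ SpaceMonomialCurve.irrelevantIdeal k * P ^ n ∧
    IsLeast {m : ℕ | 1 ≤ m ∧
      SpaceMonomialCurve.symbolicPower P (2 * m - 1)
        ≤ SpaceMonomialCurve.irrelevantIdeal k * P ^ m} n := by
  rw [hM.curveIdeal_eq] at hP
  subst hP hn
  have hlower := fun l => hM.not_symbolicPower_le (k := k) (l := l)
  have hupper := hM.symbolicPower_nIndex_le (k := k)
  refine ⟨hlower, hupper, ⟨?_, hupper⟩, fun m hm => ?_⟩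
  · simp [SpaceMonomialCurve.nIndex]
  · by_contra hlt
    exact hlower m hm.1 (by omega) hm.2
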